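/- Let $(\Omega,\mathcal F,\mathbb P)$ be a probability space. Let $\{X(s)\}_{s\in[0,1]}$ be a real centered Gaussian process whose trajectories are almost surely Hölder continuous on $[0,1]$ of order $\alpha$, for a fixed $\alpha\in(1/2,1]$, i.e. almost surely there is a finite $C(\omega)$ with $|X(s_1,\omega)-X(s_2,\omega)|\le C(\omega)|s_1-s_2|^{\alpha}$ for all $s_1,s_2\in[0,1]$. Let $\Phi:\mathbb R\to\mathbb R$ be continuously differentiable with $|\Phi(x)|+|\Phi'(x)|\le c(1+|x|)^{L}$ for all $x\in\mathbb R$, where $c,L>0$ are constants. Let $\{W(s)\}_{s\in[0,1]}$ be a standard Brownian motion independent of $X$, and let $\{Z(t)\}_{t\in[0,1]}$ be a version with almost surely continuous trajectories of the stochastic integral $$Z(t)=\int_0^t\Phi(X(s))\,dW(s).$$ For $j\in\mathbb N=\{0,1,2,\dots\}$ and $k\in\{0,\dots,2^j-1\}$ let $\varphi_{0,0}=\mathbf 1_{[0,1)}$ and $\psi_{j,k}=2^{j/2}\big(\mathbf 1_{[k2^{-j},(2k+1)2^{-j-1})}-\mathbf 1_{[(2k+1)2^{-j-1},(k+1)2^{-j})}\big)$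 be the Haar functions, and put $$\delta_{0,0}=\int_0^1\varphi_{0,0}\,dW=W(1),\qquad \lambda_{j,k}=\int_0^1\psi_{j,k}\,dW=-2^{j/2}\Big(W\big(\tfrac{k+1}{2^j}\big)-2W\big(\tfrac{2k+1}{2^{j+1}}\big)+W\big(\tfrac{k}{2^j}\big)\Big).$$ With $K(t,s,\omega)=\Phi(X(s,\omega))\mathbf 1_{[0,t]}(s)$, let $$b_{0,0}(t,\omega)=\int_0^1K(t,s,\omega)\varphi_{0,0}(s)\,ds,\qquad a_{j,k}(t,\omega)=\int_0^1K(t,s,\omega)\psi_{j,k}(s)\,ds$$ be the coefficients of $s\mapsto K(t,s,\omega)$ in the Haar basis, and for $J\in\mathbb N$ let $$Z_J(t,\omega)=b_{0,0}(t,\omega)\delta_{0,0}(\omega)+\sum_{j=0}^{J}\sum_{k=0}^{2^j-1}a_{j,k}(t,\omega)\lambda_{j,k}(\omega).$$ Let $\gamma\in[0,1/2)$ be fixed. Let $C^\gamma([0,1])$ be the space of continuous $u:[0,1]\to\mathbb R$ with finite norm $\|u\|_{C^\gamma([0,1])}=\sup_{t\in[0,1]}|u(t)|+\sup_{0\le t_1<t_2\le1}\frac{|u(t_1)-u(t_2)|}{|t_1-t_2|^\gamma}$.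 Then: (1) For every $\omega$ for which $X(\cdot,\omega)$ is Hölder continuous of order $\alpha$ on $[0,1]$ (hence almost surely), the functions $b_{0,0}(\cdot,\omega)$, $a_{j,k}(\cdot,\omega)$ and $Z_J(\cdot,\omega)$ are Lipschitz on $[0,1]$ for all $j$, $k$ and $J$; in particular $Z_J(\cdot,\omega)\in C^\gamma([0,1])$. (2) There is a positive random variable $D$ with finite moments of every order such that, almost surely, for all $J\in\mathbb N$ simultaneously, $Z-Z_J\in C^\gamma([0,1])$ and $$\|Z(\cdot,\omega)-Z_J(\cdot,\omega)\|_{C^\gamma([0,1])}\le D(\omega)\,2^{-J\min(1/2-\gamma,\ \alpha-1/2)}\sqrt{1+J}.$$ -/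

import Mathlib

open MeasureTheory ProbabilityTheory Set Filter
open scoped ENNReal NNReal Topology

noncomputable section

namespace HaarVol

/-- `W` is a standard Brownian motion on the time interval `[0, 1]`; the values of `W` at times
outside `[0, 1]` play no role. -/
structure IsBrownianUnit {Ω : Type*} [MeasurableSpace Ω] (P : Measure Ω) (W : ℝ → Ω → ℝ) :
    Prop where
  measurable : ∀ t ∈ Icc (0 : ℝ) 1, Measurable (W t)
  zero : ∀ᵐ ω ∂P, W 0 ω = 0
  indep_increments : HasIndepIncrements (fun (t : Icc (0 : ℝ) 1) ω => W t ω) P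
  law_increment : ∀ s t : ℝ, 0 ≤ s → s ≤ t → t ≤ 1 →
    HasLaw (fun ω => W t ω - W s ω) (gaussianReal 0 (t - s).toNNReal) P
  continuous : ∀ᵐ ω ∂P, ContinuousOn (fun t => W t ω) (Icc 0 1)

/-- `X` is a centered Gaussian process on the time interval `[0, 1]`; the values of `X` at times
outside `[0, 1]` play no role. -/
structure IsCenteredGaussianUnit {Ω : Type*} [MeasurableSpace Ω] (P : Measure Ω)
    (X : ℝ → Ω → ℝ) : Prop where
  measurable : ∀ s ∈ Icc (0 : ℝ) 1, Measurable (X s)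
  gaussian : IsGaussianProcess (fun (s : Icc (0 : ℝ) 1) ω => X s ω) P
  centered : ∀ s ∈ Icc (0 : ℝ) 1, ∫ ω, X s ω ∂P = 0

/-- The path `x` satisfies a Hölder condition of order `α` on `[0, 1]`. -/
def HolderPath (α : ℝ) (x : ℝ → ℝ) : Prop :=
  ∃ C : ℝ, ∀ s₁ ∈ Icc (0 : ℝ) 1, ∀ s₂ ∈ Icc (0 : ℝ) 1, |x s₁ - x s₂| ≤ C * |s₁ - s₂| ^ α

/-! ### The stochastic integral -/

/-- The sigma-algebra generated by the whole process `X` on `[0, 1]` and by `W` up to time `t`. -/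
@[reducible] def volFiltration {Ω : Type*} (X W : ℝ → Ω → ℝ) (t : ℝ) : MeasurableSpace Ω :=
  (⨆ s ∈ Icc (0 : ℝ) 1, MeasurableSpace.comap (X s) inferInstance) ⊔
    ⨆ u ∈ Icc (0 : ℝ) t, MeasurableSpace.comap (W u) inferInstance

/-- A simple process `∑_{i < n} ξ_i 1_{(t_i, t_{i+1}]}` with `t_i` nondecreasing in `[0, 1]` and
each `ξ_i` square integrable and `𝓕 (t_i)`-measurable. -/
structure SimpleProcess {Ω : Type*} [MeasurableSpace Ω] (P : Measure Ω)
    (𝓕 : ℝ → MeasurableSpace Ω) where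
  n : ℕ
  time : ℕ → ℝ
  coef : ℕ → Ω → ℝ
  time_mono : Monotone time
  time_mem : ∀ i, time i ∈ Icc (0 : ℝ) 1
  coef_measurable : ∀ i, Measurable[𝓕 (time i)] (coef i)
  coef_memLp : ∀ i, MemLp (coef i) 2 P

/-- The value at time `s` of a simple process. -/
def SimpleProcess.value {Ω : Type*} [MeasurableSpace Ω] {P : Measure Ω}
    {𝓕 : ℝ → MeasurableSpace Ω} (S : SimpleProcess P 𝓕) (s : ℝ) (ω : Ω) : ℝ :=
  ∑ i ∈ Finset.range S.n, S.coef i ω * (Ioc (S.time i) (S.time (i + 1))).indicator 1 s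

/-- The integral over `[0, t]` of a simple process against `W`. -/
def SimpleProcess.integral {Ω : Type*} [MeasurableSpace Ω] {P : Measure Ω}
    {𝓕 : ℝ → MeasurableSpace Ω} (S : SimpleProcess P 𝓕) (W : ℝ → Ω → ℝ) (t : ℝ) (ω : Ω) : ℝ :=
  ∑ i ∈ Finset.range S.n,
    S.coef i ω * (W (min (S.time (i + 1)) t) ω - W (min (S.time i) t) ω)

/-- For every `t ∈ [0, 1]`, `Z t` is a version of the Itô integral `∫_0^t H(s) dW(s)` with respect
to `𝓕`: the `L²(P)`-limit of the integrals of simple processes that approximate `H` in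
`L²([0, 1] × Ω)`. -/
def IsItoIntegral {Ω : Type*} [MeasurableSpace Ω] (P : Measure Ω) (𝓕 : ℝ → MeasurableSpace Ω)
    (W H Z : ℝ → Ω → ℝ) : Prop :=
  (∀ t ∈ Icc (0 : ℝ) 1, AEMeasurable (Z t) P) ∧
  ∃ S : ℕ → SimpleProcess P 𝓕,
    Tendsto (fun n => ∫⁻ ω, (∫⁻ s in Icc (0 : ℝ) 1, ‖(S n).value s ω - H s ω‖ₑ ^ 2) ∂P)
      atTop (𝓝 0) ∧
    ∀ t ∈ Icc (0 : ℝ) 1,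
      Tendsto (fun n => ∫⁻ ω, ‖(S n).integral W t ω - Z t ω‖ₑ ^ 2 ∂P) atTop (𝓝 0)

/-! ### Hölder spaces on `[0, 1]` -/

/-- The Hölder seminorm of order `γ` on `[0, 1]`, with values in `[0, ∞]`. -/
def holderSeminorm (γ : ℝ) (u : ℝ → ℝ) : ℝ≥0∞ :=
  ⨆ (t₁ : ℝ) (t₂ : ℝ) (_ : 0 ≤ t₁ ∧ t₁ < t₂ ∧ t₂ ≤ 1),
    ENNReal.ofReal (|u t₁ - u t₂| / |t₁ - t₂| ^ γ)

/-- The norm of `C^γ([0, 1])`, with values in `[0, ∞]`. -/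
def holderNorm (γ : ℝ) (u : ℝ → ℝ) : ℝ≥0∞ :=
  (⨆ t ∈ Icc (0 : ℝ) 1, ENNReal.ofReal |u t|) + holderSeminorm γ u

/-- Membership of (the restriction to `[0, 1]` of) `u` in the Hölder space `C^γ([0, 1])`. -/
def MemHolderSpace (γ : ℝ) (u : ℝ → ℝ) : Prop :=
  ContinuousOn u (Icc 0 1) ∧ holderSeminorm γ u < ∞

/-! ### The Haar basis and the random series -/

/-- The Haar scaling function. -/
def haarPhi (s : ℝ) : ℝ := (Ico (0 : ℝ) 1).indicator 1 s

/-- The Haar functions. -/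
def haarPsi (j k : ℕ) (s : ℝ) : ℝ :=
  (2 : ℝ) ^ ((j : ℝ) / 2) *
    ((Ico ((k : ℝ) / 2 ^ j) ((2 * k + 1 : ℝ) / 2 ^ (j + 1))).indicator 1 s -
      (Ico ((2 * k + 1 : ℝ) / 2 ^ (j + 1)) ((k + 1 : ℝ) / 2 ^ j)).indicator 1 s)

/-- The Gaussian variable `∫_0^1 φ_{0,0}(s) dW(s)`. -/
def haarDelta {Ω : Type*} (W : ℝ → Ω → ℝ) (ω : Ω) : ℝ := W 1 ω

/-- The Gaussian variables `∫_0^1 ψ_{j,k}(s) dW(s)`. -/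
def haarLambda {Ω : Type*} (W : ℝ → Ω → ℝ) (j k : ℕ) (ω : Ω) : ℝ :=
  -(2 : ℝ) ^ ((j : ℝ) / 2) *
    (W ((k + 1 : ℝ) / 2 ^ j) ω - 2 * W ((2 * k + 1 : ℝ) / 2 ^ (j + 1)) ω + W ((k : ℝ) / 2 ^ j) ω)

/-- The kernel `Φ(X(s)) 1_{[0,t]}(s)`. -/
def kernelK {Ω : Type*} (Φ : ℝ → ℝ) (X : ℝ → Ω → ℝ) (t s : ℝ) (ω : Ω) : ℝ :=
  Φ (X s ω) * (Icc (0 : ℝ) t).indicator 1 s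

/-- The coefficient of the kernel along the Haar scaling function. -/
def coefB {Ω : Type*} (Φ : ℝ → ℝ) (X : ℝ → Ω → ℝ) (t : ℝ) (ω : Ω) : ℝ :=
  ∫ s in (0 : ℝ)..1, kernelK Φ X t s ω * haarPhi s

/-- The coefficients of the kernel along the Haar functions. -/
def coefA {Ω : Type*} (Φ : ℝ → ℝ) (X : ℝ → Ω → ℝ) (j k : ℕ) (t : ℝ) (ω : Ω) : ℝ :=
  ∫ s in (0 : ℝ)..1, kernelK Φ X t s ω * haarPsi j k s

/-- The partial sums of the random series. -/
def partialZ {Ω : Type*} (Φ : ℝ → ℝ) (X W : ℝ → Ω → ℝ) (J : ℕ) (t : ℝ) (ω : Ω) : ℝ :=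
  coefB Φ X t ω * haarDelta W ω +
    ∑ j ∈ Finset.range (J + 1), ∑ k ∈ Finset.range (2 ^ j),
      coefA Φ X j k t ω * haarLambda W j k ω

end HaarVol

end

namespace HaarVol

variable {Ω : Type*} [MeasurableSpace Ω] {P : Measure Ω}

/-! ### Random variables with moments of every order -/

/-! Let `F` be the primitive of `s ↦ Φ (X s)`. The Haar coefficients of `Φ (X s) 1_{[0,t]}` are
`2^{j/2}` times second differences of `x ↦ F (min x t)` (`coefA_eq`), and `haarLambda` has the same
form in `W`. The pathwise part is therefore a study of second differences.

Take `t₁ < t₂` and the level `j` block of the series. A dyadic interval inside `[t₁, t₂]` changes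
the second difference of `F` by at most a constant times `2^{-j(1+α)}`, because `Φ (X s)` is Hölder
of order `α`. At most two intervals have `t₁` or `t₂` in their interior; they contribute at most a
constant times `min (2^{-j}) (t₂ - t₁)`. All other intervals contribute nothing
(`sum_abs_second_difference_clamp_le`). After multiplication by `2^{j/2}` and by the bound `√(1+j)`
for the Gaussian factors, the inner intervals give the rate `2^{-j(α-1/2)}` and the boundary
intervals `2^{-j(1/2-γ)} (t₂ - t₁)^γ`: this is the minimum in the exponent (`two_rpow_half_mul_le`,
`abs_blockZ_sub_le`). Both exponents are positive, so the blocks above level `J` sum geometrically,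
and `Z_{J+n} - Z_J` has a Hölder bound uniform in `n`.

It remains to see that the series sums to `Z`. The partial sum `Z_J` is exactly the dyadic sum of
level `J + 1` pairing increments of the stopped primitive with increments of `W`
(`partialZ_eq_dyadicSum`). At a dyadic time it differs from the left Riemann sum of the stochastic
integral by a multiple of `√(2+J) 2^{-(J+1)(α-1/2)}`, which vanishes since `α > 1/2`
(`abs_partialZ_sub_leftSum_le`). The Itô isometry, in the filtration that contains all of `X` from
time `0`, shows that the left sums converge to `Z` in `L²` at a geometric rate, hence almost surely
at all dyadic points (`ae_tendsto_leftSum`). Continuity of `Z` and density of the dyadic points then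
transfer the Hölder bound to `Z - Z_J`.

The random constant is a multiple of `A * G`, plus `1`. Here `A` bounds the size and Hölder constant
of `Φ (X s)`; its moments come from Fernique's theorem for the normalized increments of `X` and the
polynomial growth of `Φ`. `G` bounds the normalized dyadic increments of `W`; its moments come from
a weighted sum of exponential squares. -/

lemma memLp_of_integrable_pow [IsFiniteMeasure P] {M : Ω → ℝ} (hM : Measurable M)
    (hint : ∀ n : ℕ, Integrable (fun ω => |M ω| ^ n) P) (p : ℝ≥0) : MemLp M p P := by
  obtain ⟨n, hn⟩ := exists_nat_ge p
  have hn' : (p : ℝ≥0∞) ≤ ((n + 1 : ℕ) : ℝ≥0∞) := by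
    have : p ≤ ((n + 1 : ℕ) : ℝ≥0) := hn.trans (by push_cast; simp)
    exact_mod_cast this
  refine MemLp.mono_exponent ?_ hn'
  rw [← integrable_norm_rpow_iff hM.aestronglyMeasurable (by simp) (by simp)]
  refine (hint (n + 1)).congr (ae_of_all _ fun ω => ?_)
  simp only [Real.norm_eq_abs, ENNReal.toReal_natCast, Real.rpow_natCast]

lemma memLp_mul_of_forall {f g : Ω → ℝ} (hf : ∀ p : ℝ≥0, MemLp f p P)
    (hg : ∀ p : ℝ≥0, MemLp g p P) (p : ℝ≥0) : MemLp (fun ω => f ω * g ω) p P := by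
  have : ENNReal.HolderTriple ((2 * p : ℝ≥0) : ℝ≥0∞) ((2 * p : ℝ≥0) : ℝ≥0∞) (p : ℝ≥0∞) := by
    constructor
    by_cases hp : p = 0
    · simp [hp]
    · push_cast
      rw [ENNReal.mul_inv (by simp) (by simp), ← add_mul, ENNReal.inv_two_add_inv_two, one_mul]
  exact (hg (2 * p)).mul (hf (2 * p))

lemma memLp_pow_of_forall [IsFiniteMeasure P] {f : Ω → ℝ} (hf : ∀ p : ℝ≥0, MemLp f p P) (n : ℕ)
    (p : ℝ≥0) : MemLp (fun ω => f ω ^ n) p P := by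
  induction n generalizing p with
  | zero => simpa using memLp_const 1
  | succ n ih =>
    simp_rw [pow_succ]
    exact memLp_mul_of_forall ih hf p

/-- Each power is dominated by the exponential through one term of its series: `|M|^n ≤ 1 + (M²)^n ≤
1 + (n!/c^n) exp (c M²)`. -/
lemma memLp_of_lintegral_exp_sq_lt_top [IsFiniteMeasure P] {M : Ω → ℝ} (hM : Measurable M) {c : ℝ}
    (hc : 0 < c) (h : ∫⁻ ω, ENNReal.ofReal (Real.exp (c * M ω ^ 2)) ∂P < ∞) (p : ℝ≥0) :
    MemLp M p P := by
  refine memLp_of_integrable_pow hM (fun n => ?_) p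
  have hexp : Integrable (fun ω => Real.exp (c * M ω ^ 2)) P := by
    refine ⟨by fun_prop, ?_⟩
    rw [hasFiniteIntegral_iff_ofReal (ae_of_all _ fun ω => (Real.exp_pos _).le)]
    exact h
  refine ((integrable_const 1).add (hexp.const_mul (n.factorial / c ^ n))).mono'
    (by fun_prop) (ae_of_all _ fun ω => ?_)
  rw [Real.norm_of_nonneg (by positivity)]
  have h1 : |M ω| ^ n ≤ 1 + (M ω ^ 2) ^ n := by
    have : (M ω ^ 2) ^ n = (|M ω| ^ n) ^ 2 := by rw [← sq_abs]; ring
    rw [this]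
    nlinarith [sq_nonneg (|M ω| ^ n - 1), sq_nonneg (|M ω| ^ n)]
  have h2 := Real.pow_div_factorial_le_exp (c * M ω ^ 2) (by positivity) n
  have h3 : (M ω ^ 2) ^ n ≤ n.factorial / c ^ n * Real.exp (c * M ω ^ 2) := by
    rw [mul_pow, div_le_iff₀ (by positivity)] at h2
    rw [div_mul_eq_mul_div, le_div_iff₀ (by positivity)]
    linarith
  simp only [Pi.add_apply]
  linarith

/-! ### Suprema of Gaussian sequences -/

/-- Fernique's inequality for the finite marginals, whose centered Gaussian laws are rotation
invariant. The ball of radius `a` has mass at least `c` for every `I` at once, so the bound does not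
depend on `I`; this is what allows the passage to the whole sequence. -/
lemma lintegral_exp_sq_norm_restrict_le [IsProbabilityMeasure P] {Y : ℕ → Ω → ℝ}
    (hY : IsGaussianProcess Y P) (hmeas : ∀ i, Measurable (Y i)) (hc : ∀ i, ∫ ω, Y i ω ∂P = 0)
    {a : ℝ} {c : ℝ≥0∞} (hc_gt : 2⁻¹ < c) (ha : c ≤ P {ω | ∀ i, |Y i ω| ≤ a}) (I : Finset ℕ) :
    ∫⁻ ω, .ofReal (Real.exp (Fernique.logRatio c * a⁻¹ ^ 2 * ‖I.restrict (Y · ω)‖ ^ 2)) ∂P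
      ≤ .ofReal (Real.exp (Fernique.logRatio c))
        + ∑' n : ℕ, .ofReal (Real.exp (-2⁻¹ * Real.log (c / (1 - c)).toReal * 2 ^ n)) := by
  have hG := (hY.hasGaussianLaw I).isGaussian_map
  have hm : Measurable (fun ω => I.restrict (Y · ω)) :=
    measurable_pi_lambda _ fun i => hmeas i
  set μ := P.map (fun ω => I.restrict (Y · ω)) with hμ
  have : IsProbabilityMeasure μ := Measure.isProbabilityMeasure_map hm.aemeasurable
  have hrot := IsGaussian.map_rotation_eq_self (μ := μ) (by
    ext i
    rw [eval_integral (fun i => ?_)]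
    · simp only [id_eq]
      rw [hμ, integral_map hm.aemeasurable (measurable_pi_apply i).aestronglyMeasurable]
      simpa using hc i
    · exact (IsGaussian.integrable_id (μ := μ)).eval i) (-(Real.pi / 4))
  have key := lintegral_exp_mul_sq_norm_le_of_map_rotation_eq_self (a := a) hrot (c := c) (by
    refine ha.trans ?_
    rw [hμ, Measure.map_apply hm (measurableSet_le (by fun_prop) (by fun_prop))]
    refine measure_mono fun ω hω => ?_
    simp only [mem_preimage, mem_ofPred_eq] at hω ⊢
    have ha0 : 0 ≤ a := (abs_nonneg _).trans (hω 0)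
    rw [pi_norm_le_iff_of_nonneg ha0]
    exact fun i => hω i) hc_gt
  rwa [hμ, lintegral_map (by fun_prop) hm] at key

lemma exists_lt_measure_forall_abs_le [IsProbabilityMeasure P] {Y : ℕ → Ω → ℝ}
    (hmeas : ∀ i, Measurable (Y i)) (hbdd : ∀ᵐ ω ∂P, ∃ C, ∀ i, |Y i ω| ≤ C) {c : ℝ≥0∞}
    (hc : c < 1) : ∃ n : ℕ, c < P {ω | ∀ i, |Y i ω| ≤ n} := by
  have hlim : Tendsto (fun n : ℕ => P {ω | ∀ i, |Y i ω| ≤ n}) atTop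
      (𝓝 (P (⋃ n : ℕ, {ω | ∀ i, |Y i ω| ≤ n}))) := by
    apply tendsto_measure_iUnion_atTop
    intro n m hnm ω hω i
    exact (hω i).trans (by exact_mod_cast hnm)
  have h1 : P (⋃ n : ℕ, {ω | ∀ i, |Y i ω| ≤ n}) = 1 := by
    rw [← prob_compl_eq_zero_iff, ← mem_ae_iff]
    · filter_upwards [hbdd] with ω ⟨C, hC⟩
      obtain ⟨n, hn⟩ := exists_nat_ge C
      exact mem_iUnion.2 ⟨n, fun i => (hC i).trans hn⟩
    · refine MeasurableSet.iUnion fun n => ?_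
      simp only [ofPred_forall]
      exact MeasurableSet.iInter fun i => measurableSet_le (by fun_prop) (by fun_prop)
  rw [h1] at hlim
  exact (hlim.eventually (lt_mem_nhds hc)).exists

/-- An almost surely bounded centered Gaussian sequence is dominated by a random variable with
moments of every order. -/
theorem exists_memLp_forall_abs_le_of_isGaussianProcess [IsProbabilityMeasure P] {Y : ℕ → Ω → ℝ}
    (hY : IsGaussianProcess Y P) (hmeas : ∀ i, Measurable (Y i)) (hc : ∀ i, ∫ ω, Y i ω ∂P = 0)
    (hbdd : ∀ᵐ ω ∂P, ∃ C, ∀ i, |Y i ω| ≤ C) :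
    ∃ M : Ω → ℝ, Measurable M ∧ (∀ ω, 0 ≤ M ω) ∧ (∀ p : ℝ≥0, MemLp M p P) ∧
      ∀ᵐ ω ∂P, ∀ i, |Y i ω| ≤ M ω := by
  -- Any level strictly between `1/2` and `1` would do: then `log (c / (1 - c)) > 0` and the series
  -- in Fernique's bound converges.
  set c : ℝ≥0∞ := 3 / 4
  have hc1 : c < 1 := by
    rw [ENNReal.div_lt_iff (by simp) (by simp)]; norm_num
  have hc2 : 2⁻¹ < c := by
    rw [ENNReal.lt_div_iff_mul_lt (by simp) (by simp)]
    rw [show (4 : ℝ≥0∞) = 2 * 2 by norm_num, ← mul_assoc, ENNReal.inv_mul_cancel (by simp) (by simp)]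
    norm_num
  obtain ⟨a, ha⟩ := exists_lt_measure_forall_abs_le hmeas hbdd hc1
  -- The radius is enlarged by one only to be positive, since its inverse enters the exponent.
  obtain ⟨b, hb⟩ : ∃ b : ℝ, 0 < b ∧ c ≤ P {ω | ∀ i, |Y i ω| ≤ b} := by
    refine ⟨a + 1, by positivity, ha.le.trans (measure_mono fun ω hω i => (hω i).trans (by simp))⟩
  set C : ℝ := Fernique.logRatio c * b⁻¹ ^ 2
  have hC : 0 < C := mul_pos (Fernique.logRatio_pos hc2 hc1) (by have := hb.1; positivity)
  have hne : (1 - c) ≠ ∞ := by finiteness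
  set K : ℝ≥0∞ := .ofReal (Real.exp (Fernique.logRatio c))
        + ∑' n : ℕ, .ofReal (Real.exp (-2⁻¹ * Real.log (c / (1 - c)).toReal * 2 ^ n)) with hK
  have hKlt : K < ∞ := by
    refine ENNReal.add_lt_top.mpr ⟨ENNReal.ofReal_lt_top, ?_⟩
    refine Summable.tsum_ofReal_lt_top <|
      Real.summable_exp_nat_mul_of_ge ?_ (fun i ↦ mod_cast (Nat.lt_pow_self (by simp)).le)
    refine mul_neg_of_neg_of_pos (by simp) (Real.log_pos ?_)
    have h4 : (1 - c).toReal = 1 / 4 := by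
      rw [ENNReal.toReal_sub_of_le hc1.le (by simp)]
      simp [c]
      norm_num
    rw [ENNReal.toReal_div, h4]
    simp only [c, ENNReal.toReal_div, ENNReal.toReal_ofNat]
    norm_num
  set S : Ω → ℝ≥0∞ := fun ω => ⨆ i, ENNReal.ofReal |Y i ω|
  have hS : Measurable S := Measurable.iSup fun i => by
    have := hmeas i
    fun_prop
  have hle : ∀ᵐ ω ∂P, ∀ i, |Y i ω| ≤ (S ω).toReal := by
    filter_upwards [hbdd] with ω ⟨B, hB⟩ i
    have hfin : S ω ≠ ∞ := by
      refine ne_top_of_le_ne_top (ENNReal.ofReal_ne_top (r := B)) (iSup_le fun i => ?_)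
      exact ENNReal.ofReal_le_ofReal (hB i)
    rw [← ENNReal.ofReal_le_iff_le_toReal hfin]
    exact le_iSup (fun i => ENNReal.ofReal |Y i ω|) i
  refine ⟨fun ω => (S ω).toReal, hS.ennreal_toReal, fun ω => ENNReal.toReal_nonneg, ?_, hle⟩
  refine memLp_of_lintegral_exp_sq_lt_top hS.ennreal_toReal hC (lt_of_le_of_lt ?_ hKlt)
  -- The sup norms of the first `n` coordinates tend to the supremum of the sequence, so Fatou's
  -- lemma carries the uniform Fernique bound to the supremum.
  set g : ℕ → Ω → ℝ≥0∞ := fun n ω =>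
    .ofReal (Real.exp (C * ‖(Finset.range n).restrict (Y · ω)‖ ^ 2))
  have hg : ∀ n, Measurable (g n) := fun n => by
    have : Measurable (fun ω => (Finset.range n).restrict (Y · ω)) :=
      measurable_pi_lambda _ fun i => hmeas i
    fun_prop
  calc ∫⁻ ω, .ofReal (Real.exp (C * (S ω).toReal ^ 2)) ∂P
    _ ≤ ∫⁻ ω, liminf (fun n => g n ω) atTop ∂P := by
      refine lintegral_mono_ae ?_
      filter_upwards [hle] with ω hω
      have hlim : Tendsto (fun n => ‖(Finset.range n).restrict (Y · ω)‖) atTop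
          (𝓝 (S ω).toReal) := by
        refine tendsto_order.2 ⟨fun x hx => ?_, fun x hx => Eventually.of_forall fun n => ?_⟩
        · rcases lt_or_ge x 0 with hx0 | hx0
          · exact Eventually.of_forall fun n => hx0.trans_le (norm_nonneg _)
          have : ENNReal.ofReal x < S ω := (ENNReal.lt_ofReal_iff_toReal_lt (by simp)).2 (by
            rwa [ENNReal.toReal_ofReal hx0]) |>.trans_le ENNReal.ofReal_toReal_le
          obtain ⟨i, hi⟩ := lt_iSup_iff.1 this
          rw [ENNReal.ofReal_lt_ofReal_iff_of_nonneg hx0] at hi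
          filter_upwards [eventually_gt_atTop i] with n hn
          exact hi.trans_le (norm_le_pi_norm ((Finset.range n).restrict (Y · ω))
            ⟨i, Finset.mem_range.2 hn⟩)
        · refine lt_of_le_of_lt ?_ hx
          rw [pi_norm_le_iff_of_nonneg ENNReal.toReal_nonneg]
          exact fun i => hω i
      refine le_of_eq (Tendsto.liminf_eq ?_).symm
      exact ENNReal.tendsto_ofReal ((Real.continuous_exp.tendsto _).comp
        ((hlim.pow 2).const_mul C))
    _ ≤ liminf (fun n => ∫⁻ ω, g n ω ∂P) atTop := lintegral_liminf_le hg
    _ ≤ K := by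
      refine liminf_le_of_le (by isBoundedDefault) fun x hx => ?_
      obtain ⟨n, hn⟩ := hx.exists
      exact hn.trans (lintegral_exp_sq_norm_restrict_le hY hmeas hc hc2 hb.2 _)

end HaarVol

/-! ### Moments of the Hölder constant of `X` and of the dyadic increments of `W` -/

namespace HaarVol

variable {Ω : Type*} [MeasurableSpace Ω] {P : Measure Ω}

lemma isGaussianProcess_mul_add_mul {T S : Type*} {X : T → Ω → ℝ} (hX : IsGaussianProcess X P)
    (a b : S → T) (c d : S → ℝ) :
    IsGaussianProcess (fun n ω => c n * X (a n) ω + d n * X (b n) ω) P := by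
  classical
  refine hX.of_isGaussianProcess fun n => ⟨{a n, b n},
    c n • ContinuousLinearMap.proj ⟨a n, by simp⟩ +
      d n • ContinuousLinearMap.proj ⟨b n, by simp⟩, fun ω => ?_⟩
  simp

/-- The sup norm and the Hölder constant of a Hölder continuous centered Gaussian process have
moments of every order. -/
theorem IsCenteredGaussianUnit.exists_memLp_holder_bound [IsProbabilityMeasure P]
    {X : ℝ → Ω → ℝ} (hX : IsCenteredGaussianUnit P X) {α : ℝ} (hα : 0 < α)
    (hXα : ∀ᵐ ω ∂P, HolderPath α (fun s => X s ω)) :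
    ∃ M : Ω → ℝ, Measurable M ∧ (∀ ω, 0 ≤ M ω) ∧ (∀ p : ℝ≥0, MemLp M p P) ∧
      ∀ᵐ ω ∂P, (∀ s ∈ Icc (0 : ℝ) 1, |X s ω| ≤ 2 * M ω) ∧
        ∀ s ∈ Icc (0 : ℝ) 1, ∀ t ∈ Icc (0 : ℝ) 1, |X s ω - X t ω| ≤ M ω * |s - t| ^ α := by
  have hne : Nonempty (Icc (0 : ℝ) 1) := ⟨⟨0, by simp⟩⟩
  set d := TopologicalSpace.denseSeq (Icc (0 : ℝ) 1)
  have hd : DenseRange d := TopologicalSpace.denseRange_denseSeq _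
  set z : Icc (0 : ℝ) 1 := ⟨0, by simp⟩
  -- One Gaussian sequence encodes everything: index `0` is `X 0`, and index `n + 1` is the Hölder
  -- quotient of the `n`-th pair of points of a dense sequence. For coinciding points the quotient
  -- is `0`, because the inverse of `0` is `0`.
  set a : ℕ → Icc (0 : ℝ) 1 := fun n => if n = 0 then z else d (n - 1).unpair.1
  set b : ℕ → Icc (0 : ℝ) 1 := fun n => if n = 0 then z else d (n - 1).unpair.2
  set u : ℕ → ℝ := fun n => if n = 0 then 1 else (|(a n : ℝ) - b n| ^ α)⁻¹
  set v : ℕ → ℝ := fun n => if n = 0 then 0 else -(|(a n : ℝ) - b n| ^ α)⁻¹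
  set Y : ℕ → Ω → ℝ := fun n ω => u n * X (a n) ω + v n * X (b n) ω with hYdef
  have hYG : IsGaussianProcess Y P := isGaussianProcess_mul_add_mul hX.gaussian a b u v
  have hint : ∀ s : Icc (0 : ℝ) 1, Integrable (fun ω => X s ω) P := fun s =>
    (hX.gaussian.hasGaussianLaw_eval s).integrable
  have hmeas : ∀ s : Icc (0 : ℝ) 1, Measurable (X s) := fun s => hX.measurable s s.2
  obtain ⟨M, hMm, hM0, hMp, hM⟩ := exists_memLp_forall_abs_le_of_isGaussianProcess hYG
    (fun n => ((hmeas (a n)).const_mul _).add ((hmeas (b n)).const_mul _))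
    (fun n => by
      simp only [hYdef]
      rw [integral_add ((hint _).const_mul _) ((hint _).const_mul _), integral_const_mul,
        integral_const_mul, hX.centered _ (a n).2, hX.centered _ (b n).2]
      simp) (by
      filter_upwards [hXα] with ω ⟨C, hC⟩
      refine ⟨|X 0 ω| + |C|, fun n => ?_⟩
      rcases Nat.eq_zero_or_pos n with rfl | hn
      · simp [hYdef, u, v, a, z]
      · have hn0 : n ≠ 0 := hn.ne'
        simp only [hYdef, u, v, hn0, if_false]
        rw [neg_mul, ← sub_eq_add_neg, ← mul_sub, abs_mul, abs_of_nonneg (by positivity)]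
        have h1 := hC (a n) (a n).2 (b n) (b n).2
        have h2 : 0 ≤ |(a n : ℝ) - b n| ^ α := by positivity
        rcases h2.eq_or_lt' with h0 | h0
        · rw [h0]; simp; positivity
        · rw [inv_mul_le_iff₀ h0]
          have : C ≤ |X 0 ω| + |C| := by linarith [le_abs_self C, abs_nonneg (X 0 ω)]
          nlinarith)
  refine ⟨M, hMm, hM0, hMp, ?_⟩
  filter_upwards [hM, hXα] with ω hω ⟨C, hC⟩
  have hcont : Continuous (fun s : Icc (0 : ℝ) 1 => X s ω) := by
    rw [continuous_iff_continuousAt]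
    intro s
    rw [ContinuousAt, tendsto_iff_dist_tendsto_zero]
    have hlim : Tendsto (fun t : Icc (0 : ℝ) 1 => C * |(t : ℝ) - s| ^ α) (𝓝 s) (𝓝 0) := by
      have : Continuous (fun t : Icc (0 : ℝ) 1 => C * |(t : ℝ) - s| ^ α) :=
        continuous_const.mul (Continuous.rpow_const (by fun_prop) fun _ => Or.inr hα.le)
      simpa [Real.zero_rpow hα.ne'] using this.tendsto s
    exact squeeze_zero (fun _ => dist_nonneg) (fun t => hC t t.2 s s.2) hlim
  have hH : ∀ s t : Icc (0 : ℝ) 1, |X s ω - X t ω| ≤ M ω * |(s : ℝ) - t| ^ α := by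
    refine hd.induction_on₂ ?_ ?_
    · exact isClosed_le ((hcont.comp continuous_fst).sub (hcont.comp continuous_snd)).abs
        (continuous_const.mul (Continuous.rpow_const (by fun_prop) fun _ => Or.inr hα.le))
    · intro i j
      have h := hω (Nat.pair i j + 1)
      simp only [hYdef, u, v, a, b, Nat.succ_ne_zero, if_false, Nat.add_sub_cancel,
        Nat.unpair_pair] at h
      rw [neg_mul, ← sub_eq_add_neg, ← mul_sub, abs_mul, abs_of_nonneg (by positivity)] at h
      have h2 : 0 ≤ |(d i : ℝ) - d j| ^ α := by positivity
      -- For coinciding points the quotient carries no information; the inequality is then read off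
      -- from the Hölder property of the path.
      rcases h2.eq_or_lt' with h0 | h0
      · have h3 := hC (d i) (d i).2 (d j) (d j).2
        rw [h0] at h3 ⊢
        simpa using h3
      · rw [inv_mul_le_iff₀ h0] at h
        linarith
  refine ⟨fun s hs => ?_, fun s hs t ht => hH ⟨s, hs⟩ ⟨t, ht⟩⟩
  have h0 := hω 0
  simp [hYdef, u, v, a, z] at h0
  have h1 := hH ⟨s, hs⟩ z
  simp only [z, sub_zero] at h1
  have h2 : |s| ^ α ≤ 1 := Real.rpow_le_one (abs_nonneg _) (by rw [abs_of_nonneg hs.1]; exact hs.2)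
    hα.le
  have h3 : M ω * |s| ^ α ≤ M ω * 1 := mul_le_mul_of_nonneg_left h2 (hM0 ω)
  have h4 : |X s ω| ≤ |X s ω - X 0 ω| + |X 0 ω| := by
    simpa using abs_add_le (X s ω - X 0 ω) (X 0 ω)
  linarith

/-- The dyadic increments of Brownian motion, normalized by `√(1 + j)`, are dominated by a random
variable with moments of every order. -/
theorem IsBrownianUnit.exists_memLp_dyadic_bound [IsProbabilityMeasure P] {W : ℝ → Ω → ℝ}
    (hW : IsBrownianUnit P W) :
    ∃ G : Ω → ℝ, Measurable G ∧ (∀ ω, 0 ≤ G ω) ∧ (∀ p : ℝ≥0, MemLp G p P) ∧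
      ∀ᵐ ω ∂P, ∀ j k : ℕ, k < 2 ^ j →
        (2 : ℝ) ^ ((j : ℝ) / 2) * |W ((k + 1 : ℝ) / 2 ^ j) ω - W ((k : ℝ) / 2 ^ j) ω| ≤
          G ω * √(1 + j) := by
  have hmem : ∀ j k : ℕ, k < 2 ^ j →
      (k + 1 : ℝ) / 2 ^ j ∈ Icc (0 : ℝ) 1 ∧ (k : ℝ) / 2 ^ j ∈ Icc (0 : ℝ) 1 := by
    intro j k hk
    have h : (k : ℝ) + 1 ≤ 2 ^ j := by exact_mod_cast hk
    refine ⟨⟨by positivity, (div_le_one (by positivity)).2 h⟩, ⟨by positivity,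
      (div_le_one (by positivity)).2 (by linarith)⟩⟩
  set N : ℕ → ℕ → Ω → ℝ := fun j k ω =>
    (2 : ℝ) ^ ((j : ℝ) / 2) * (W ((k + 1 : ℝ) / 2 ^ j) ω - W ((k : ℝ) / 2 ^ j) ω) with hN
  have hNm : ∀ j k, k < 2 ^ j → Measurable (N j k) := fun j k hk =>
    ((hW.measurable _ (hmem j k hk).1).sub (hW.measurable _ (hmem j k hk).2)).const_mul _
  have hNl : ∀ j k, k < 2 ^ j → HasLaw (N j k) (gaussianReal 0 1) P := by
    intro j k hk
    have h := hW.law_increment _ _ (hmem j k hk).2.1 (by gcongr; linarith) (hmem j k hk).1.2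
    have h2 := gaussianReal_const_mul h ((2 : ℝ) ^ ((j : ℝ) / 2))
    convert h2 using 1
    congr 1
    · simp
    · ext
      push_cast
      rw [Real.coe_toNNReal _ (by rw [sub_nonneg]; gcongr; linarith), ← Real.rpow_natCast,
        ← Real.rpow_mul (by norm_num), Nat.cast_ofNat, div_mul_cancel₀ _ (by norm_num),
        Real.rpow_natCast]
      field_simp
      ring
  obtain ⟨C, hC, hint⟩ := IsGaussian.exists_integrable_exp_sq (gaussianReal 0 1)
  set K : ℝ≥0∞ := ∫⁻ x, ENNReal.ofReal (Real.exp (C * ‖x‖ ^ 2)) ∂(gaussianReal 0 1) with hK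
  have hKtop : K ≠ ∞ := by
    have h := hint.2
    rw [hasFiniteIntegral_iff_ofReal (ae_of_all _ fun ω => (Real.exp_pos _).le)] at h
    exact h.ne
  set E : ℕ → ℕ → Ω → ℝ≥0∞ := fun j k ω => ENNReal.ofReal (Real.exp (C * N j k ω ^ 2)) with hE
  -- Level `j` has `2^j` identically distributed terms, so the weight `4^{-j}` leaves `2^{-j}` in
  -- expectation and `Y` is integrable. No independence between the increments is used.
  set Y : Ω → ℝ≥0∞ := fun ω => ∑' j : ℕ, (4 ^ j)⁻¹ * ∑ k ∈ Finset.range (2 ^ j), E j k ω with hY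
  have hEm : ∀ j k, k < 2 ^ j → Measurable (E j k) := fun j k hk => by
    have := hNm j k hk
    fun_prop
  have hSm : ∀ j, Measurable (fun ω => ∑ k ∈ Finset.range (2 ^ j), E j k ω) := fun j =>
    Finset.measurable_sum _ fun k hk => hEm j k (Finset.mem_range.1 hk)
  have hYm : Measurable Y := Measurable.tsum fun j => (hSm j).const_mul _
  have hYint : ∫⁻ ω, Y ω ∂P ≠ ∞ := by
    have h1 : ∀ j k, k < 2 ^ j → ∫⁻ ω, E j k ω ∂P = K := by
      intro j k hk
      rw [hK, ← (hNl j k hk).map_eq, lintegral_map (by fun_prop) (hNm j k hk)]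
      simp [hE]
    have h2 : ∫⁻ ω, Y ω ∂P = ∑' j : ℕ, (2⁻¹ : ℝ≥0∞) ^ j * K := by
      rw [hY, lintegral_tsum fun j => ((hSm j).const_mul _).aemeasurable]
      congr 1
      ext j
      rw [lintegral_const_mul _ (hSm j), lintegral_finsetSum' _ fun k hk =>
        (hEm j k (Finset.mem_range.1 hk)).aemeasurable,
        Finset.sum_congr rfl fun k hk => h1 j k (Finset.mem_range.1 hk)]
      rw [Finset.sum_const, Finset.card_range, nsmul_eq_mul, ← mul_assoc]
      congr 1
      push_cast
      rw [show (4 : ℝ≥0∞) = 2 * 2 by norm_num, mul_pow,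
        ENNReal.mul_inv (by simp) (by simp), mul_assoc, ENNReal.inv_mul_cancel (by simp) (by simp),
        mul_one, ENNReal.inv_pow]
    rw [h2, ENNReal.tsum_mul_right, ENNReal.tsum_geometric]
    refine ENNReal.mul_ne_top ?_ hKtop
    simp
  have hYfin : ∀ᵐ ω ∂P, Y ω < ∞ := ae_lt_top hYm hYint
  set y : Ω → ℝ := fun ω => (Y ω).toReal with hy
  have hy0 : ∀ ω, 0 ≤ y ω := fun ω => ENNReal.toReal_nonneg
  have hym : Measurable y := hYm.ennreal_toReal
  have hyint : Integrable y P := integrable_toReal_of_lintegral_ne_top hYm.aemeasurable hYint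
  have hlog : ∀ ω, 0 ≤ Real.log (1 + y ω) := fun ω => Real.log_nonneg (by linarith [hy0 ω])
  -- From `exp (C N²) ≤ 4^j y` one gets `C N² ≤ j log 4 + log (1 + y) ≤ (1 + j) (2 + log (1 + y))`,
  -- which dictates this witness. Its exponential square is `e² (1 + y)`, hence integrable.
  refine ⟨fun ω => √((2 + Real.log (1 + y ω)) / C), by fun_prop, fun ω => Real.sqrt_nonneg _, ?_, ?_⟩
  · refine fun p => memLp_of_lintegral_exp_sq_lt_top (by fun_prop) hC ?_ p
    have : ∀ ω, Real.exp (C * √((2 + Real.log (1 + y ω)) / C) ^ 2) =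
        Real.exp 2 * (1 + y ω) := by
      intro ω
      rw [Real.sq_sqrt (div_nonneg (by linarith [hlog ω]) hC.le), mul_div_cancel₀ _ hC.ne',
        Real.exp_add, Real.exp_log (by linarith [hy0 ω])]
    simp_rw [this]
    have hI : Integrable (fun ω => Real.exp 2 * (1 + y ω)) P :=
      ((integrable_const 1).add hyint).const_mul _
    have h := hI.2
    rwa [hasFiniteIntegral_iff_ofReal (ae_of_all _ fun ω =>
      mul_nonneg (Real.exp_pos _).le (by linarith [hy0 ω]))] at h
  · filter_upwards [hYfin] with ω hω j k hk
    have h1 : (4 ^ j)⁻¹ * E j k ω ≤ Y ω :=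
      le_trans (mul_le_mul_right (Finset.single_le_sum (f := fun k => E j k ω)
        (fun _ _ => zero_le) (Finset.mem_range.2 hk)) _)
        (ENNReal.le_tsum (f := fun j : ℕ => (4 ^ j)⁻¹ * ∑ k ∈ Finset.range (2 ^ j), E j k ω) j)
    have h2 : Real.exp (C * N j k ω ^ 2) ≤ 4 ^ j * y ω := by
      have h3 := ENNReal.toReal_mono hω.ne h1
      rw [ENNReal.toReal_mul, ENNReal.toReal_inv, ENNReal.toReal_pow,
        ENNReal.toReal_ofReal (Real.exp_pos _).le, ENNReal.toReal_ofNat,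
        inv_mul_le_iff₀ (by positivity)] at h3
      exact h3
    have h4 : C * N j k ω ^ 2 ≤ (1 + j) * (2 + Real.log (1 + y ω)) := by
      have h5 : Real.exp (C * N j k ω ^ 2) ≤
          Real.exp (j * Real.log 4 + Real.log (1 + y ω)) := by
        rw [Real.exp_add, mul_comm (j : ℝ), Real.exp_mul (Real.log 4), Real.exp_log (by norm_num),
          Real.exp_log (by linarith [hy0 ω]), Real.rpow_natCast]
        refine h2.trans (mul_le_mul_of_nonneg_left (by linarith) (by positivity))
      have h6 : Real.log 4 ≤ 2 := by
        rw [show (4 : ℝ) = 2 ^ 2 by norm_num, Real.log_pow]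
        have := Real.log_two_lt_d9
        push_cast
        linarith
      have h7 := Real.exp_le_exp.1 h5
      have h8 : (j : ℝ) * Real.log 4 ≤ j * 2 := mul_le_mul_of_nonneg_left h6 (by positivity)
      have h9 : 0 ≤ (j : ℝ) * Real.log (1 + y ω) := mul_nonneg (by positivity) (hlog ω)
      linarith
    have h10 : (2 : ℝ) ^ ((j : ℝ) / 2) * |W ((k + 1 : ℝ) / 2 ^ j) ω - W ((k : ℝ) / 2 ^ j) ω| =
        |N j k ω| := by
      rw [hN, abs_mul, abs_of_nonneg (a := (2 : ℝ) ^ ((j : ℝ) / 2)) (by positivity)]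
    rw [h10, ← Real.sqrt_mul (div_nonneg (by linarith [hlog ω]) hC.le)]
    refine Real.abs_le_sqrt ?_
    rw [div_mul_eq_mul_div, le_div_iff₀ hC]
    linarith

end HaarVol

namespace HaarVol

/-! ### Haar coefficients through the primitive -/

/-- The primitive of `f` vanishing at `0`. -/
noncomputable def primitive (f : ℝ → ℝ) (x : ℝ) : ℝ := ∫ s in (0 : ℝ)..x, f s

section Primitive

variable {f : ℝ → ℝ}

lemma intervalIntegrable_of_continuousOn_unit (hf : ContinuousOn f (Icc 0 1)) {x y : ℝ}
    (hx : x ∈ Icc (0 : ℝ) 1) (hy : y ∈ Icc (0 : ℝ) 1) : IntervalIntegrable f volume x y :=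
  (hf.mono ((convex_Icc 0 1).ordConnected.uIcc_subset hx hy)).intervalIntegrable

lemma primitive_sub (hf : ContinuousOn f (Icc 0 1)) {x y : ℝ} (hx : x ∈ Icc (0 : ℝ) 1)
    (hy : y ∈ Icc (0 : ℝ) 1) : primitive f y - primitive f x = ∫ s in x..y, f s :=
  intervalIntegral.integral_interval_sub_left
    (intervalIntegrable_of_continuousOn_unit hf (by simp) hy)
    (intervalIntegrable_of_continuousOn_unit hf (by simp) hx)

lemma abs_primitive_sub_le (hf : ContinuousOn f (Icc 0 1)) {A : ℝ}
    (hA : ∀ s ∈ Icc (0 : ℝ) 1, |f s| ≤ A) {x y : ℝ} (hx : x ∈ Icc (0 : ℝ) 1)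
    (hy : y ∈ Icc (0 : ℝ) 1) : |primitive f y - primitive f x| ≤ A * |y - x| := by
  rw [primitive_sub hf hx hy]
  exact intervalIntegral.norm_integral_le_of_norm_le_const (f := f) (C := A) fun s hs =>
    hA s ((convex_Icc 0 1).ordConnected.uIcc_subset hx hy (uIoc_subset_uIcc hs))

/-- Cutting the integrand at `t` amounts to stopping both endpoints of the interval at `t`. The two
integrands can differ only at the points `0`, `a`, `b` and `t`. -/
lemma integral_mul_indicator_mul_indicator (hf : ContinuousOn f (Icc 0 1)) {t a b : ℝ}
    (ht : t ∈ Icc (0 : ℝ) 1) (ha : 0 ≤ a) (hab : a ≤ b) :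
    IntervalIntegrable (fun s => f s * (Icc (0 : ℝ) t).indicator 1 s * (Ico a b).indicator 1 s)
      volume 0 1 ∧
    ∫ s in (0 : ℝ)..1, f s * (Icc (0 : ℝ) t).indicator 1 s * (Ico a b).indicator 1 s =
      primitive f (min b t) - primitive f (min a t) := by
  have hat : min a t ∈ Icc (0 : ℝ) 1 := ⟨le_min ha ht.1, (min_le_right _ _).trans ht.2⟩
  have hbt : min b t ∈ Icc (0 : ℝ) 1 := ⟨le_min (ha.trans hab) ht.1, (min_le_right _ _).trans ht.2⟩
  have hmm : min a t ≤ min b t := min_le_min_right t hab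
  have hae : ∀ᵐ s ∂(volume : Measure ℝ),
      f s * (Icc (0 : ℝ) t).indicator 1 s * (Ico a b).indicator 1 s =
        (Ioc (min a t) (min b t)).indicator f s := by
    have h : ∀ x : ℝ, ∀ᵐ s ∂(volume : Measure ℝ), s ≠ x := fun x => by
      simp [ae_iff]
    filter_upwards [h 0, h a, h b, h t] with s h0 h1 h2 h3
    by_cases hs : s ∈ Ioc (min a t) (min b t)
    · have h4 : s ≤ b := hs.2.trans (min_le_left _ _)
      have h5 : s ≤ t := hs.2.trans (min_le_right _ _)
      have h6 : a < s := (min_lt_iff.1 hs.1).resolve_right (by linarith)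
      rw [indicator_of_mem hs, indicator_of_mem (show s ∈ Icc 0 t from ⟨by linarith, h5⟩),
        indicator_of_mem (show s ∈ Ico a b from ⟨h6.le, lt_of_le_of_ne h4 h2⟩)]
      simp
    · rw [indicator_of_notMem hs]
      by_cases h4 : s ∈ Icc (0 : ℝ) t
      · by_cases h5 : s ∈ Ico a b
        · exact absurd ⟨min_lt_of_left_lt (lt_of_le_of_ne h5.1 h1.symm),
            le_min h5.2.le h4.2⟩ hs
        · simp [indicator_of_notMem h5]
      · simp [indicator_of_notMem h4]
  have hsub : Ioc (min a t) (min b t) ⊆ Ioc (0 : ℝ) 1 := Ioc_subset_Ioc hat.1 hbt.2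
  have hint := intervalIntegrable_of_continuousOn_unit hf hat hbt
  constructor
  · rw [intervalIntegrable_iff_integrableOn_Ioc_of_le zero_le_one]
    refine Integrable.congr (f := (Ioc (min a t) (min b t)).indicator f) ?_
      ((ae_restrict_of_ae hae).mono fun s hs => hs.symm)
    rw [intervalIntegrable_iff_integrableOn_Ioc_of_le hmm] at hint
    exact (hint.integrable_indicator measurableSet_Ioc).integrableOn
  · rw [intervalIntegral.integral_congr_ae (hae.mono fun s hs _ => hs),
      intervalIntegral.integral_of_le zero_le_one, setIntegral_indicator measurableSet_Ioc,
      inter_eq_right.2 hsub, primitive_sub hf hat hbt, intervalIntegral.integral_of_le hmm]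

end Primitive

section Coef

variable {Ω : Type*} {Φ : ℝ → ℝ} {X : ℝ → Ω → ℝ} {ω : Ω}

lemma coefB_eq (hf : ContinuousOn (fun s => Φ (X s ω)) (Icc 0 1)) {t : ℝ}
    (ht : t ∈ Icc (0 : ℝ) 1) :
    coefB Φ X t ω = primitive (fun s => Φ (X s ω)) t := by
  have h := (integral_mul_indicator_mul_indicator hf ht le_rfl zero_le_one).2
  rw [min_eq_right ht.2, min_eq_left ht.1] at h
  simpa [coefB, kernelK, haarPhi, primitive] using h

lemma dyadic_mem {j k : ℕ} (hk : k < 2 ^ j) :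
    0 ≤ (k : ℝ) / 2 ^ j ∧ (k : ℝ) / 2 ^ j ≤ (2 * k + 1 : ℝ) / 2 ^ (j + 1) ∧
      (2 * k + 1 : ℝ) / 2 ^ (j + 1) ≤ (k + 1 : ℝ) / 2 ^ j ∧ (k + 1 : ℝ) / 2 ^ j ≤ 1 := by
  have h : (k : ℝ) + 1 ≤ 2 ^ j := by exact_mod_cast hk
  have hp : (0 : ℝ) < 2 ^ j := by positivity
  refine ⟨by positivity, ?_, ?_, (div_le_one hp).2 h⟩
  · rw [pow_succ, div_le_div_iff₀ hp (by positivity)]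
    nlinarith
  · rw [pow_succ, div_le_div_iff₀ (by positivity) hp]
    nlinarith

/-- The two halves of the Haar function contribute increments of the stopped primitive with opposite
signs. All later estimates of the coefficients start from this second difference. -/
lemma coefA_eq (hf : ContinuousOn (fun s => Φ (X s ω)) (Icc 0 1)) {j k : ℕ} (hk : k < 2 ^ j)
    {t : ℝ} (ht : t ∈ Icc (0 : ℝ) 1) :
    coefA Φ X j k t ω = (2 : ℝ) ^ ((j : ℝ) / 2) *
      (2 * primitive (fun s => Φ (X s ω)) (min ((2 * k + 1 : ℝ) / 2 ^ (j + 1)) t) -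
        primitive (fun s => Φ (X s ω)) (min ((k : ℝ) / 2 ^ j) t) -
        primitive (fun s => Φ (X s ω)) (min ((k + 1 : ℝ) / 2 ^ j) t)) := by
  obtain ⟨h1, h2, h3, h4⟩ := dyadic_mem hk
  have e1 := integral_mul_indicator_mul_indicator hf ht h1 h2
  have e2 := integral_mul_indicator_mul_indicator hf ht (h1.trans h2) h3
  have : coefA Φ X j k t ω = ∫ s in (0 : ℝ)..1, (2 : ℝ) ^ ((j : ℝ) / 2) *
      (Φ (X s ω) * (Icc (0 : ℝ) t).indicator 1 s *
          (Ico ((k : ℝ) / 2 ^ j) ((2 * k + 1 : ℝ) / 2 ^ (j + 1))).indicator 1 s -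
        Φ (X s ω) * (Icc (0 : ℝ) t).indicator 1 s *
          (Ico ((2 * k + 1 : ℝ) / 2 ^ (j + 1)) ((k + 1 : ℝ) / 2 ^ j)).indicator 1 s) := by
    unfold coefA kernelK haarPsi
    congr 1
    ext s
    ring
  rw [this, intervalIntegral.integral_const_mul, intervalIntegral.integral_sub e1.1 e2.1, e1.2,
    e2.2]
  ring

end Coef

/-! ### Lipschitz and Hölder functions on the unit interval -/

lemma exists_lipschitzOnWith_of_abs_sub_le {u : ℝ → ℝ} {K : ℝ}
    (h : ∀ s ∈ Icc (0 : ℝ) 1, ∀ t ∈ Icc (0 : ℝ) 1, |u s - u t| ≤ K * |s - t|) :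
    ∃ K : ℝ≥0, LipschitzOnWith K u (Icc 0 1) :=
  ⟨K.toNNReal, LipschitzOnWith.of_dist_le_mul fun s hs t ht =>
    (h s hs t ht).trans (mul_le_mul_of_nonneg_right (Real.le_coe_toNNReal K) (abs_nonneg _))⟩

lemma holderSeminorm_le {γ K : ℝ} {u : ℝ → ℝ}
    (h : ∀ s t : ℝ, 0 ≤ s → s < t → t ≤ 1 → |u s - u t| ≤ K * |s - t| ^ γ) :
    holderSeminorm γ u ≤ ENNReal.ofReal K := by
  refine iSup_le fun s => iSup_le fun t => iSup_le fun hst => ENNReal.ofReal_le_ofReal ?_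
  rw [div_le_iff₀ (Real.rpow_pos_of_pos (abs_pos.2 (sub_ne_zero.2 hst.2.1.ne)) _)]
  exact h s t hst.1 hst.2.1 hst.2.2

lemma memHolderSpace_of_abs_sub_le {γ K : ℝ} (hγ : γ ≤ 1) {u : ℝ → ℝ}
    (h : ∀ s ∈ Icc (0 : ℝ) 1, ∀ t ∈ Icc (0 : ℝ) 1, |u s - u t| ≤ K * |s - t|) :
    MemHolderSpace γ u := by
  obtain ⟨K', hK'⟩ := exists_lipschitzOnWith_of_abs_sub_le h
  refine ⟨hK'.continuousOn, lt_of_le_of_lt (holderSeminorm_le (K := |K|) fun s t h0 hst h1 => ?_)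
    ENNReal.ofReal_lt_top⟩
  refine (h s ⟨h0, by linarith⟩ t ⟨by linarith, h1⟩).trans ?_
  refine mul_le_mul (le_abs_self K) ?_ (abs_nonneg _) (abs_nonneg _)
  have hpos : 0 < |s - t| := abs_pos.2 (sub_ne_zero.2 hst.ne)
  refine (Real.rpow_le_rpow_of_exponent_ge hpos ?_ hγ).trans' (by simp)
  rw [abs_le]
  constructor <;> linarith

section Lipschitz

variable {Ω : Type*} {Φ : ℝ → ℝ} {X W : ℝ → Ω → ℝ} {ω : Ω} {A : ℝ}

lemma abs_coefB_sub_le (hf : ContinuousOn (fun s => Φ (X s ω)) (Icc 0 1))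
    (hA : ∀ s ∈ Icc (0 : ℝ) 1, |Φ (X s ω)| ≤ A) {s t : ℝ} (hs : s ∈ Icc (0 : ℝ) 1)
    (ht : t ∈ Icc (0 : ℝ) 1) : |coefB Φ X s ω - coefB Φ X t ω| ≤ A * |s - t| := by
  rw [coefB_eq hf hs, coefB_eq hf ht]
  exact abs_primitive_sub_le hf hA ht hs

lemma abs_coefA_sub_le (hf : ContinuousOn (fun s => Φ (X s ω)) (Icc 0 1))
    (hA : ∀ s ∈ Icc (0 : ℝ) 1, |Φ (X s ω)| ≤ A) {j k : ℕ} (hk : k < 2 ^ j) {s t : ℝ}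
    (hs : s ∈ Icc (0 : ℝ) 1) (ht : t ∈ Icc (0 : ℝ) 1) :
    |coefA Φ X j k s ω - coefA Φ X j k t ω| ≤ (2 : ℝ) ^ ((j : ℝ) / 2) * (4 * A) * |s - t| := by
  have hA0 : 0 ≤ A := (abs_nonneg _).trans (hA s hs)
  obtain ⟨h1, h2, h3, h4⟩ := dyadic_mem hk
  have key : ∀ x : ℝ, 0 ≤ x → |primitive (fun s => Φ (X s ω)) (min x s) -
      primitive (fun s => Φ (X s ω)) (min x t)| ≤ A * |s - t| := by
    intro x hx
    refine (abs_primitive_sub_le hf hA ⟨le_min hx ht.1, (min_le_right _ _).trans ht.2⟩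
      ⟨le_min hx hs.1, (min_le_right _ _).trans hs.2⟩).trans (mul_le_mul_of_nonneg_left ?_ hA0)
    simpa using abs_min_sub_min_le_max x s x t
  rw [coefA_eq hf hk hs, coefA_eq hf hk ht, ← mul_sub, abs_mul, abs_of_nonneg (a := _ ^ _)
    (by positivity), mul_assoc]
  refine mul_le_mul_of_nonneg_left ?_ (by positivity)
  have k1 := abs_le.1 (key _ h1)
  have k2 := abs_le.1 (key _ (h1.trans h2))
  have k3 := abs_le.1 (key _ ((h1.trans h2).trans h3))
  rw [abs_le]
  constructor <;> linarith

lemma exists_abs_partialZ_sub_le (hf : ContinuousOn (fun s => Φ (X s ω)) (Icc 0 1)) (J : ℕ) :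
    ∃ K : ℝ, ∀ s ∈ Icc (0 : ℝ) 1, ∀ t ∈ Icc (0 : ℝ) 1,
      |partialZ Φ X W J s ω - partialZ Φ X W J t ω| ≤ K * |s - t| := by
  obtain ⟨A, hA⟩ := isCompact_Icc.exists_bound_of_continuousOn hf
  refine ⟨A * |haarDelta W ω| + ∑ j ∈ Finset.range (J + 1), ∑ k ∈ Finset.range (2 ^ j),
    (2 : ℝ) ^ ((j : ℝ) / 2) * (4 * A) * |haarLambda W j k ω|, fun s hs t ht => ?_⟩
  have e : partialZ Φ X W J s ω - partialZ Φ X W J t ω =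
      (coefB Φ X s ω - coefB Φ X t ω) * haarDelta W ω +
        ∑ j ∈ Finset.range (J + 1), ∑ k ∈ Finset.range (2 ^ j),
          (coefA Φ X j k s ω - coefA Φ X j k t ω) * haarLambda W j k ω := by
    simp only [partialZ, sub_mul, Finset.sum_sub_distrib]
    ring
  rw [e, add_mul, Finset.sum_mul]
  refine (abs_add_le _ _).trans (add_le_add ?_ ?_)
  · rw [abs_mul, mul_right_comm]
    exact mul_le_mul_of_nonneg_right (abs_coefB_sub_le hf hA hs ht) (abs_nonneg _)
  · refine (Finset.abs_sum_le_sum_abs _ _).trans (Finset.sum_le_sum fun j _ => ?_)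
    rw [Finset.sum_mul]
    refine (Finset.abs_sum_le_sum_abs _ _).trans (Finset.sum_le_sum fun k hk => ?_)
    rw [abs_mul, mul_right_comm]
    exact mul_le_mul_of_nonneg_right (abs_coefA_sub_le hf hA (Finset.mem_range.1 hk) hs ht)
      (abs_nonneg _)

lemma HolderPath.continuousOn {α : ℝ} (hα : 0 < α) {x : ℝ → ℝ} (hx : HolderPath α x) :
    ContinuousOn x (Icc 0 1) := by
  obtain ⟨C, hC⟩ := hx
  intro s hs
  rw [ContinuousWithinAt, tendsto_iff_dist_tendsto_zero]
  have hlim : Tendsto (fun t : ℝ => C * |t - s| ^ α) (𝓝[Icc 0 1] s) (𝓝 0) := by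
    have : Continuous (fun t : ℝ => C * |t - s| ^ α) :=
      continuous_const.mul (Continuous.rpow_const (by fun_prop) fun _ => Or.inr hα.le)
    simpa [Real.zero_rpow hα.ne'] using (this.tendsto s).mono_left nhdsWithin_le_nhds
  exact squeeze_zero' (Eventually.of_forall fun _ => dist_nonneg)
    (eventually_nhdsWithin_of_forall fun t ht => hC t ht s hs) hlim

end Lipschitz

/-! ### Blocks of the random series -/

section Block

variable {F : ℝ → ℝ} {A α : ℝ}

/-- Going from `t₁` to `t₂` replaces the stopped function by `F` composed with the clamp `c` onto
`[t₁, t₂]`. Intervals inside `[t₁, t₂]` are estimated by `hF2` and their lengths telescope to at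
most `t₂ - t₁`; on intervals outside, `c` is constant and the second difference vanishes. An
interval with an endpoint `t₁` or `t₂` in its interior is estimated by `hF1` only; there are at most
two, hence the factor `2`. -/
lemma sum_abs_second_difference_clamp_le (hA : 0 ≤ A) (hα : 0 ≤ α)
    (hF1 : ∀ x ∈ Icc (0 : ℝ) 1, ∀ y ∈ Icc (0 : ℝ) 1, |F y - F x| ≤ A * |y - x|)
    (hF2 : ∀ x h : ℝ, 0 ≤ x → 0 ≤ h → x + 2 * h ≤ 1 →
      |2 * F (x + h) - F x - F (x + 2 * h)| ≤ A * (h ^ α * h))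
    (j : ℕ) {t₁ t₂ : ℝ} (h0 : 0 ≤ t₁) (h12 : t₁ ≤ t₂) (h1 : t₂ ≤ 1) :
    ∑ k ∈ Finset.range (2 ^ j),
      |(2 * F (min ((2 * k + 1 : ℝ) / 2 ^ (j + 1)) t₂) - F (min ((k : ℝ) / 2 ^ j) t₂) -
          F (min ((k + 1 : ℝ) / 2 ^ j) t₂)) -
        (2 * F (min ((2 * k + 1 : ℝ) / 2 ^ (j + 1)) t₁) - F (min ((k : ℝ) / 2 ^ j) t₁) -
          F (min ((k + 1 : ℝ) / 2 ^ j) t₁))| ≤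
      A * ((1 / 2 ^ j : ℝ) ^ α * (t₂ - t₁) + 2 * min (1 / 2 ^ j) (t₂ - t₁)) := by
  set h : ℝ := 1 / 2 ^ j with hh
  have hpos : 0 < h := by positivity
  set τ := t₂ - t₁ with hτ
  set c : ℝ → ℝ := fun x => max t₁ (min x t₂) with hc
  have hc_mono : Monotone c := fun x y hxy => max_le_max_left _ (min_le_min_right _ hxy)
  have hc_mem : ∀ x, c x ∈ Icc t₁ t₂ := fun x => ⟨le_max_left _ _, max_le h12 (min_le_right _ _)⟩
  have hc_unit : ∀ x, c x ∈ Icc (0 : ℝ) 1 := fun x =>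
    ⟨h0.trans (hc_mem x).1, (hc_mem x).2.trans h1⟩
  have hc_lip : ∀ x y, x ≤ y → c y - c x ≤ y - x := by
    intro x y hxy
    simp only [hc]
    rcases max_cases t₁ (min x t₂) with h | h <;> rcases max_cases t₁ (min y t₂) with h' | h' <;>
      rcases min_cases x t₂ with g | g <;> rcases min_cases y t₂ with g' | g' <;> linarith
  -- The constant `F t₁` drops out of second differences, whose weights `2, -1, -1` sum to zero.
  have hclamp : ∀ x, F (min x t₂) - F (min x t₁) = F (c x) - F t₁ := by
    intro x
    simp only [hc]
    rcases le_total x t₁ with hx | hx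
    · rw [min_eq_left hx, min_eq_left (hx.trans h12), max_eq_left hx]; ring
    · rw [min_eq_right hx, max_eq_right (le_min hx h12)]
  set l : ℕ → ℝ := fun k => (k : ℝ) / 2 ^ j with hl
  set m : ℕ → ℝ := fun k => (2 * k + 1 : ℝ) / 2 ^ (j + 1) with hm
  have hlm : ∀ k, m k = l k + h / 2 := fun k => by simp only [hm, hl, hh]; field_simp; ring
  have hlr : ∀ k : ℕ, (k + 1 : ℝ) / 2 ^ j = l k + h := fun k => by simp only [hl, hh]; ring
  have hls : ∀ k : ℕ, l (k + 1) = l k + h := fun k => by simp only [hl, hh]; push_cast; ring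
  -- A point lies in the interior of at most one interval of the level, and the floor names it. This
  -- lets the exceptional intervals be charged by an indicator of a single index.
  have hfloor : ∀ (k : ℕ) (t : ℝ), l k < t → t < l k + h → k = ⌊t * 2 ^ j⌋₊ := by
    intro k t ha hb
    have hp : (0 : ℝ) < 2 ^ j := by positivity
    have hl0 : 0 ≤ l k := by positivity
    symm
    rw [Nat.floor_eq_iff (by nlinarith)]
    rw [← hlr, lt_div_iff₀ hp] at hb
    simp only [hl] at ha
    rw [div_lt_iff₀ hp] at ha
    exact ⟨ha.le, hb⟩
  have hmin0 : 0 ≤ A * min h τ := mul_nonneg hA (le_min hpos.le (by linarith))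
  have hite : ∀ p : Prop, [Decidable p] → 0 ≤ (if p then A * min h τ else 0) := fun p _ => by
    split_ifs <;> simp [hmin0]
  have key : ∀ k ∈ Finset.range (2 ^ j),
      |(2 * F (min (m k) t₂) - F (min (l k) t₂) - F (min ((k + 1 : ℝ) / 2 ^ j) t₂)) -
        (2 * F (min (m k) t₁) - F (min (l k) t₁) - F (min ((k + 1 : ℝ) / 2 ^ j) t₁))| ≤
      A * h ^ α * (c (l (k + 1)) - c (l k)) + (if k = ⌊t₁ * 2 ^ j⌋₊ then A * min h τ else 0) +
        (if k = ⌊t₂ * 2 ^ j⌋₊ then A * min h τ else 0) := by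
    intro k _
    have hl0 : 0 ≤ l k := by positivity
    have e : (2 * F (min (m k) t₂) - F (min (l k) t₂) - F (min ((k + 1 : ℝ) / 2 ^ j) t₂)) -
        (2 * F (min (m k) t₁) - F (min (l k) t₁) - F (min ((k + 1 : ℝ) / 2 ^ j) t₁)) =
        2 * F (c (l k + h / 2)) - F (c (l k)) - F (c (l k + h)) := by
      have e1 := hclamp (m k)
      have e2 := hclamp (l k)
      have e3 := hclamp ((k + 1 : ℝ) / 2 ^ j)
      rw [← hlm, ← hlr]
      linarith
    rw [e, hls]
    have hb : |2 * F (c (l k + h / 2)) - F (c (l k)) - F (c (l k + h))| ≤ A * min h τ := by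
      have i1 := hF1 _ (hc_unit (l k)) _ (hc_unit (l k + h / 2))
      have i2 := hF1 _ (hc_unit (l k + h / 2)) _ (hc_unit (l k + h))
      rw [abs_of_nonneg (sub_nonneg.2 (hc_mono (by linarith)))] at i1 i2
      have i3 : c (l k + h) - c (l k) ≤ min h τ :=
        le_min (by linarith [hc_lip (l k) (l k + h) (by linarith)])
          (by linarith [(hc_mem (l k + h)).2, (hc_mem (l k)).1])
      have i4 := mul_le_mul_of_nonneg_left i3 hA
      rw [abs_le] at *
      constructor <;> linarith
    have hfirst : 0 ≤ A * h ^ α * (c (l k + h) - c (l k)) :=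
      mul_nonneg (by positivity) (sub_nonneg.2 (hc_mono (by linarith)))
    by_cases c1 : l k < t₁ ∧ t₁ < l k + h
    · rw [if_pos (hfloor k t₁ c1.1 c1.2)]
      linarith [hite (k = ⌊t₂ * 2 ^ j⌋₊)]
    by_cases c2 : l k < t₂ ∧ t₂ < l k + h
    · rw [if_pos (hfloor k t₂ c2.1 c2.2)]
      linarith [hite (k = ⌊t₁ * 2 ^ j⌋₊)]
    suffices |2 * F (c (l k + h / 2)) - F (c (l k)) - F (c (l k + h))| ≤
        A * h ^ α * (c (l k + h) - c (l k)) by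
      linarith [hite (k = ⌊t₂ * 2 ^ j⌋₊), hite (k = ⌊t₁ * 2 ^ j⌋₊)]
    have hconst : ∀ y, c (l k) = y → c (l k + h) = y →
        |2 * F (c (l k + h / 2)) - F (c (l k)) - F (c (l k + h))| ≤
        A * h ^ α * (c (l k + h) - c (l k)) := by
      intro y e1 e2
      have e3 : c (l k + h / 2) = y := le_antisymm
        (e2 ▸ hc_mono (by linarith)) (e1 ▸ hc_mono (by linarith))
      rw [e1, e2, e3]
      simp [two_mul]
    rcases le_or_gt (l k + h) t₁ with g1 | g1
    · refine hconst t₁ ?_ ?_ <;> simp only [hc] <;> rw [min_eq_left, max_eq_left] <;> linarith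
    rcases le_or_gt t₂ (l k) with g2 | g2
    · refine hconst t₂ ?_ ?_ <;> simp only [hc] <;> rw [min_eq_right, max_eq_right] <;> linarith
    have g3 : t₁ ≤ l k := not_lt.1 fun g => c1 ⟨g, g1⟩
    have g4 : l k + h ≤ t₂ := not_lt.1 fun g => c2 ⟨g2, g⟩
    have hid : ∀ x, t₁ ≤ x → x ≤ t₂ → c x = x := fun x ha hb => by
      simp only [hc]; rw [min_eq_left hb, max_eq_right ha]
    rw [hid _ g3 (by linarith), hid _ (by linarith) g4, hid _ (by linarith) (by linarith)]
    have := hF2 (l k) (h / 2) hl0 (by linarith) (by linarith)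
    rw [show l k + 2 * (h / 2) = l k + h by ring] at this
    refine this.trans ?_
    rw [mul_assoc]
    refine mul_le_mul_of_nonneg_left ?_ hA
    refine mul_le_mul (Real.rpow_le_rpow (by positivity) (by linarith) hα) (by linarith)
      (by positivity) (by positivity)
  refine (Finset.sum_le_sum key).trans ?_
  rw [Finset.sum_add_distrib, Finset.sum_add_distrib, ← Finset.mul_sum,
    Finset.sum_range_sub (fun k => c (l k)), Finset.sum_ite_eq', Finset.sum_ite_eq']
  have i1 : c (l (2 ^ j)) - c (l 0) ≤ τ := by
    linarith [(hc_mem (l (2 ^ j))).2, (hc_mem (l 0)).1]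
  have i2 := mul_le_mul_of_nonneg_left i1 (mul_nonneg hA (Real.rpow_nonneg hpos.le α))
  -- The floor index may fall outside the range: it equals `2^j` when the point is `1`. Its
  -- contribution is then zero, so an inequality suffices.
  have i3 : ∀ p : Prop, [Decidable p] → (if p then A * min h τ else 0) ≤ A * min h τ :=
    fun p _ => by split_ifs <;> simp [hmin0]
  linarith [i3 (⌊t₁ * 2 ^ j⌋₊ ∈ Finset.range (2 ^ j)), i3 (⌊t₂ * 2 ^ j⌋₊ ∈ Finset.range (2 ^ j))]

lemma two_rpow_neg_natCast_mul (j : ℕ) (x : ℝ) :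
    (2 : ℝ) ^ (-((j : ℝ) * x)) = (1 / 2 ^ j : ℝ) ^ x := by
  rw [one_div, ← Real.rpow_natCast, ← Real.rpow_neg (by norm_num), ← Real.rpow_mul (by norm_num)]
  congr 1
  ring

lemma two_rpow_natCast_half (j : ℕ) :
    (2 : ℝ) ^ ((j : ℝ) / 2) = (1 / 2 ^ j : ℝ) ^ (-(1 / 2) : ℝ) := by
  rw [← two_rpow_neg_natCast_mul]
  congr 1
  ring

/-- With `h = 2^{-j} ≤ 1`, the first summand is at most `h^{α-1/2} τ^γ` because `τ ≤ 1`. The second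
uses the interpolation `min h τ ≤ h^{1-γ} τ^γ` and gives `2 h^{1/2-γ} τ^γ`. -/
lemma two_rpow_half_mul_le {α β γ : ℝ} (hγ : 0 ≤ γ) (hγ1 : γ ≤ 1) (hβα : β ≤ α - 1 / 2)
    (hβγ : β ≤ 1 / 2 - γ) (j : ℕ) {τ : ℝ} (h0 : 0 < τ) (h1 : τ ≤ 1) :
    (2 : ℝ) ^ ((j : ℝ) / 2) * ((1 / 2 ^ j : ℝ) ^ α * τ + 2 * min (1 / 2 ^ j) τ) ≤
      3 * ((2 : ℝ) ^ (-((j : ℝ) * β)) * τ ^ γ) := by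
  set h : ℝ := 1 / 2 ^ j with hh
  have hpos : 0 < h := by positivity
  have hle : h ≤ 1 := by
    rw [hh, div_le_one (by positivity)]; exact one_le_pow₀ (by norm_num)
  rw [two_rpow_natCast_half, two_rpow_neg_natCast_mul, ← hh, mul_add]
  have e1 : h ^ (-(1 / 2) : ℝ) * (h ^ α * τ) ≤ h ^ β * τ ^ γ := by
    rw [← mul_assoc, ← Real.rpow_add hpos]
    refine mul_le_mul (Real.rpow_le_rpow_of_exponent_ge hpos hle (by linarith)) ?_ h0.le
      (by positivity)
    exact (Real.rpow_le_rpow_of_exponent_ge h0 h1 hγ1).trans' (by simp)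
  have e2 : h ^ (-(1 / 2) : ℝ) * min h τ ≤ h ^ β * τ ^ γ := by
    have hm : 0 < min h τ := lt_min hpos h0
    have e3 : min h τ ≤ h ^ (1 - γ) * τ ^ γ := by
      calc min h τ = min h τ ^ (1 - γ) * min h τ ^ γ := by
            rw [← Real.rpow_add hm]; simp
        _ ≤ _ := mul_le_mul (Real.rpow_le_rpow hm.le (min_le_left _ _) (by linarith))
            (Real.rpow_le_rpow hm.le (min_le_right _ _) hγ) (by positivity) (by positivity)
    refine (mul_le_mul_of_nonneg_left e3 (by positivity)).trans ?_
    rw [← mul_assoc, ← Real.rpow_add hpos]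
    exact mul_le_mul_of_nonneg_right (Real.rpow_le_rpow_of_exponent_ge hpos hle (by linarith))
      (by positivity)
  linarith

end Block

end HaarVol

namespace HaarVol

/-! ### Tails of the random series -/

section Block

variable {f : ℝ → ℝ} {A α : ℝ}

/-- Translating the second half onto the first writes the second difference as the integral of `f s
- f (s + h)` over an interval of length `h`. -/
lemma abs_primitive_second_difference_le (hf : ContinuousOn f (Icc 0 1))
    (hA : ∀ s ∈ Icc (0 : ℝ) 1, ∀ t ∈ Icc (0 : ℝ) 1, |f s - f t| ≤ A * |s - t| ^ α)
    {x h : ℝ} (hx : 0 ≤ x) (hh : 0 ≤ h) (hxh : x + 2 * h ≤ 1) :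
    |2 * primitive f (x + h) - primitive f x - primitive f (x + 2 * h)| ≤ A * (h ^ α * h) := by
  have m0 : x ∈ Icc (0 : ℝ) 1 := ⟨hx, by linarith⟩
  have m1 : x + h ∈ Icc (0 : ℝ) 1 := ⟨by linarith, by linarith⟩
  have m2 : x + 2 * h ∈ Icc (0 : ℝ) 1 := ⟨by linarith, by linarith⟩
  have e1 := primitive_sub hf m0 m1
  have e2 := primitive_sub hf m1 m2
  have e3 : ∫ s in (x + h)..(x + 2 * h), f s = ∫ s in x..(x + h), f (s + h) := by
    rw [intervalIntegral.integral_comp_add_right]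
    congr 1
    ring
  have i1 := intervalIntegrable_of_continuousOn_unit hf m0 m1
  have i2 : IntervalIntegrable (fun s => f (s + h)) volume x (x + h) := by
    have := (intervalIntegrable_of_continuousOn_unit hf m1 m2).comp_add_right h
    rwa [add_sub_cancel_right, show x + 2 * h - h = x + h by ring] at this
  have e4 : 2 * primitive f (x + h) - primitive f x - primitive f (x + 2 * h) =
      ∫ s in x..(x + h), (f s - f (s + h)) := by
    rw [intervalIntegral.integral_sub i1 i2, ← e3, ← e1, ← e2]
    ring
  rw [e4]
  have := intervalIntegral.norm_integral_le_of_norm_le_const (a := x) (b := x + h)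
    (f := fun s => f s - f (s + h)) (C := A * h ^ α) fun s hs => by
    rw [uIoc_of_le (by linarith)] at hs
    have := hA s ⟨by linarith [hs.1], by linarith [hs.2]⟩ (s + h)
      ⟨by linarith [hs.1], by linarith [hs.2]⟩
    rwa [show s - (s + h) = -h by ring, abs_neg, abs_of_nonneg hh] at this
  rwa [show x + h - x = h by ring, abs_of_nonneg hh, Real.norm_eq_abs, mul_assoc] at this

/-- The left side is the integral of `f s - f x`. It serves to compare the cell averages in the Haar
sum with the left endpoint values in the Riemann sum. -/
lemma abs_primitive_sub_left_le (hα : 0 ≤ α) (hf : ContinuousOn f (Icc 0 1))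
    (hA0 : 0 ≤ A) (hA : ∀ s ∈ Icc (0 : ℝ) 1, ∀ t ∈ Icc (0 : ℝ) 1, |f s - f t| ≤ A * |s - t| ^ α)
    {x h : ℝ} (hx : 0 ≤ x) (hh : 0 ≤ h) (hxh : x + h ≤ 1) :
    |primitive f (x + h) - primitive f x - h * f x| ≤ A * h ^ α * h := by
  have m0 : x ∈ Icc (0 : ℝ) 1 := ⟨hx, by linarith⟩
  have m1 : x + h ∈ Icc (0 : ℝ) 1 := ⟨by linarith, by linarith⟩
  have e : primitive f (x + h) - primitive f x - h * f x = ∫ s in x..(x + h), (f s - f x) := by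
    rw [primitive_sub hf m0 m1, intervalIntegral.integral_sub
      (intervalIntegrable_of_continuousOn_unit hf m0 m1) (by simp),
      intervalIntegral.integral_const]
    simp
  rw [e]
  have := intervalIntegral.norm_integral_le_of_norm_le_const (a := x) (b := x + h)
    (f := fun s => f s - f x) (C := A * h ^ α) fun s hs => by
    rw [uIoc_of_le (by linarith)] at hs
    refine (hA s ⟨by linarith [hs.1], by linarith [hs.2]⟩ x m0).trans
      (mul_le_mul_of_nonneg_left (Real.rpow_le_rpow (abs_nonneg _) ?_ hα) hA0)
    rw [abs_le]
    constructor <;> linarith [hs.1, hs.2]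
  rwa [show x + h - x = h by ring, abs_of_nonneg hh, Real.norm_eq_abs] at this

end Block

/-- The contribution of the level `j` to the random series. -/
noncomputable def blockZ {Ω : Type*} (Φ : ℝ → ℝ) (X W : ℝ → Ω → ℝ) (j : ℕ) (t : ℝ) (ω : Ω) : ℝ :=
  ∑ k ∈ Finset.range (2 ^ j), coefA Φ X j k t ω * haarLambda W j k ω

section Tail

variable {Ω : Type*} {Φ : ℝ → ℝ} {X W : ℝ → Ω → ℝ} {ω : Ω} {A B α β γ : ℝ}

lemma partialZ_add (J n : ℕ) (t : ℝ) :
    partialZ Φ X W (J + n) t ω =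
      partialZ Φ X W J t ω + ∑ i ∈ Finset.range n, blockZ Φ X W (J + 1 + i) t ω := by
  unfold partialZ
  rw [show J + n + 1 = J + 1 + n by ring, Finset.sum_range_add, add_assoc]
  rfl

/-- Pulling out the uniform bound on the Gaussian factors leaves the absolute sum of second
differences of the primitive. No cancellation between different `k` is needed, since `α > 1/2` will
make the exponent positive. -/
lemma abs_blockZ_sub_le (hα : 0 ≤ α) (hf : ContinuousOn (fun s => Φ (X s ω)) (Icc 0 1))
    (hA : ∀ s ∈ Icc (0 : ℝ) 1, |Φ (X s ω)| ≤ A)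
    (hA' : ∀ s ∈ Icc (0 : ℝ) 1, ∀ t ∈ Icc (0 : ℝ) 1,
      |Φ (X s ω) - Φ (X t ω)| ≤ A * |s - t| ^ α)
    (hB : ∀ j k : ℕ, k < 2 ^ j → |haarLambda W j k ω| ≤ B * √(1 + j))
    (hγ : 0 ≤ γ) (hγ1 : γ ≤ 1) (hβα : β ≤ α - 1 / 2) (hβγ : β ≤ 1 / 2 - γ)
    (j : ℕ) {t₁ t₂ : ℝ} (h0 : 0 ≤ t₁) (h12 : t₁ < t₂) (h1 : t₂ ≤ 1) :
    |blockZ Φ X W j t₂ ω - blockZ Φ X W j t₁ ω| ≤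
      3 * A * B * (√(1 + j) * (2 : ℝ) ^ (-((j : ℝ) * β))) * (t₂ - t₁) ^ γ := by
  have hA0 : 0 ≤ A := (abs_nonneg _).trans (hA 0 (by simp))
  have hB0 : 0 ≤ B * √(1 + j) := (abs_nonneg _).trans (hB j 0 (by positivity))
  have m1 : t₁ ∈ Icc (0 : ℝ) 1 := ⟨h0, by linarith⟩
  have m2 : t₂ ∈ Icc (0 : ℝ) 1 := ⟨by linarith, h1⟩
  set F := primitive (fun s => Φ (X s ω)) with hF
  have hsum := sum_abs_second_difference_clamp_le (F := F) hA0 hα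
    (fun x hx y hy => abs_primitive_sub_le hf hA hx hy)
    (fun x h hx hh hxh => abs_primitive_second_difference_le hf hA' hx hh hxh)
    j h0 h12.le h1
  have hpow := two_rpow_half_mul_le hγ hγ1 hβα hβγ j (sub_pos.2 h12) (by linarith)
  calc |blockZ Φ X W j t₂ ω - blockZ Φ X W j t₁ ω|
      = |∑ k ∈ Finset.range (2 ^ j),
          (coefA Φ X j k t₂ ω - coefA Φ X j k t₁ ω) * haarLambda W j k ω| := by
        simp only [blockZ, sub_mul, Finset.sum_sub_distrib]
    _ ≤ ∑ k ∈ Finset.range (2 ^ j), (2 : ℝ) ^ ((j : ℝ) / 2) *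
      |(2 * F (min ((2 * k + 1 : ℝ) / 2 ^ (j + 1)) t₂) - F (min ((k : ℝ) / 2 ^ j) t₂) -
          F (min ((k + 1 : ℝ) / 2 ^ j) t₂)) -
        (2 * F (min ((2 * k + 1 : ℝ) / 2 ^ (j + 1)) t₁) - F (min ((k : ℝ) / 2 ^ j) t₁) -
          F (min ((k + 1 : ℝ) / 2 ^ j) t₁))| * (B * √(1 + j)) := by
        refine (Finset.abs_sum_le_sum_abs _ _).trans (Finset.sum_le_sum fun k hk => ?_)
        have hk' := Finset.mem_range.1 hk
        rw [coefA_eq hf hk' m1, coefA_eq hf hk' m2, ← mul_sub, abs_mul, abs_mul,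
          abs_of_nonneg (a := _ ^ _) (by positivity)]
        exact mul_le_mul_of_nonneg_left (hB j k hk') (by positivity)
    _ ≤ (2 : ℝ) ^ ((j : ℝ) / 2) *
        (A * ((1 / 2 ^ j : ℝ) ^ α * (t₂ - t₁) + 2 * min (1 / 2 ^ j) (t₂ - t₁))) *
        (B * √(1 + j)) := by
        rw [← Finset.sum_mul, ← Finset.mul_sum]
        exact mul_le_mul_of_nonneg_right (mul_le_mul_of_nonneg_left hsum (by positivity)) hB0
    _ = A * (B * √(1 + j)) * ((2 : ℝ) ^ ((j : ℝ) / 2) *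
        ((1 / 2 ^ j : ℝ) ^ α * (t₂ - t₁) + 2 * min (1 / 2 ^ j) (t₂ - t₁))) := by ring
    _ ≤ A * (B * √(1 + j)) * (3 * ((2 : ℝ) ^ (-((j : ℝ) * β)) * (t₂ - t₁) ^ γ)) :=
        mul_le_mul_of_nonneg_left hpow (mul_nonneg hA0 hB0)
    _ = _ := by ring

/-- The square root factors up to a linear loss, `√(2 + J + i) ≤ √(1 + J) (2 + i)`, and the
geometric factor `2^{-iβ}` absorbs that loss; `κ` is the resulting series. -/
lemma exists_sum_sqrt_mul_two_rpow_le (hβ : 0 < β) :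
    ∃ κ : ℝ, 0 < κ ∧ ∀ J n : ℕ, ∑ i ∈ Finset.range n,
      √(1 + (J + 1 + i : ℕ)) * (2 : ℝ) ^ (-(((J + 1 + i : ℕ) : ℝ) * β)) ≤
        κ * (2 : ℝ) ^ (-((J : ℝ) * β)) * √(1 + J) := by
  set q : ℝ := (2 : ℝ) ^ (-β) with hq
  have hq0 : 0 < q := by positivity
  have hq1 : q < 1 := Real.rpow_lt_one_of_one_lt_of_neg (by norm_num) (by linarith)
  have hpow : ∀ n : ℕ, (2 : ℝ) ^ (-((n : ℝ) * β)) = q ^ n := fun n => by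
    rw [hq, ← Real.rpow_natCast, ← Real.rpow_mul (by norm_num)]
    congr 1
    ring
  have hs : Summable (fun i : ℕ => (2 + i : ℝ) * q ^ i) := by
    have h1 := (summable_geometric_of_lt_one hq0.le hq1).mul_left 2
    have h2 := summable_pow_mul_geometric_of_norm_lt_one 1 (r := q)
      (by rwa [Real.norm_of_nonneg hq0.le])
    refine (h1.add h2).congr fun i => ?_
    simp only [pow_one]
    ring
  refine ⟨∑' i : ℕ, (2 + i : ℝ) * q ^ i, ?_, fun J n => ?_⟩
  · refine hs.tsum_pos (fun i => by positivity) 0 (by simp)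
  · rw [mul_assoc, mul_comm]
    refine le_trans ?_ (mul_le_mul_of_nonneg_left (hs.sum_le_tsum (Finset.range n)
      fun i _ => by positivity) (by positivity))
    rw [Finset.mul_sum]
    refine Finset.sum_le_sum fun i _ => ?_
    rw [hpow, hpow]
    have h1 : √(1 + (J + 1 + i : ℕ)) ≤ √(1 + J) * (2 + i) := by
      rw [← Real.sqrt_sq (show (0 : ℝ) ≤ 2 + i by positivity), ← Real.sqrt_mul (by positivity)]
      refine Real.sqrt_le_sqrt ?_
      push_cast
      have : (0 : ℝ) ≤ J := by positivity
      have : (0 : ℝ) ≤ i := by positivity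
      nlinarith [mul_nonneg ‹(0 : ℝ) ≤ J› ‹(0 : ℝ) ≤ i›, mul_nonneg ‹(0 : ℝ) ≤ J› (sq_nonneg (i : ℝ))]
    have h2 : q ^ (J + 1 + i) ≤ q ^ J * q ^ i := by
      rw [← pow_add]
      exact pow_le_pow_of_le_one hq0.le hq1.le (by omega)
    calc √(1 + (J + 1 + i : ℕ)) * q ^ (J + 1 + i)
        ≤ (√(1 + J) * (2 + i)) * (q ^ J * q ^ i) :=
          mul_le_mul h1 h2 (by positivity) (by positivity)
      _ = _ := by ring

end Tail

/-! ### The Haar expansion as a dyadic sum -/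

lemma sum_range_two_mul {M : Type*} [AddCommMonoid M] (a : ℕ → M) (n : ℕ) :
    ∑ m ∈ Finset.range (2 * n), a m = ∑ k ∈ Finset.range n, (a (2 * k) + a (2 * k + 1)) := by
  induction n with
  | zero => simp
  | succ n ih =>
    rw [show 2 * (n + 1) = 2 * n + 1 + 1 by ring, Finset.sum_range_succ, Finset.sum_range_succ, ih,
      Finset.sum_range_succ, add_assoc]

/-- The dyadic sum of level `N` of the products of the increments of `U` and `V`. -/
noncomputable def dyadicSum (U V : ℝ → ℝ) (N : ℕ) : ℝ :=
  ∑ m ∈ Finset.range (2 ^ N), 2 ^ N * (U ((m + 1 : ℝ) / 2 ^ N) - U ((m : ℝ) / 2 ^ N)) *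
    (V ((m + 1 : ℝ) / 2 ^ N) - V ((m : ℝ) / 2 ^ N))

/-- On each cell this is `2 (u₁ v₁ + u₂ v₂) = (u₁ + u₂) (v₁ + v₂) + (u₁ - u₂) (v₁ - v₂)`, applied to
the increments over the two halves. -/
lemma dyadicSum_succ (U V : ℝ → ℝ) (j : ℕ) :
    dyadicSum U V (j + 1) = dyadicSum U V j + ∑ k ∈ Finset.range (2 ^ j), 2 ^ j *
      (2 * U ((2 * k + 1 : ℝ) / 2 ^ (j + 1)) - U ((k : ℝ) / 2 ^ j) - U ((k + 1 : ℝ) / 2 ^ j)) *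
      (2 * V ((2 * k + 1 : ℝ) / 2 ^ (j + 1)) - V ((k : ℝ) / 2 ^ j) - V ((k + 1 : ℝ) / 2 ^ j)) := by
  unfold dyadicSum
  rw [pow_succ' 2 j, sum_range_two_mul, ← Finset.sum_add_distrib]
  refine Finset.sum_congr rfl fun k _ => ?_
  have hp : (2 : ℝ) ^ j ≠ 0 := by positivity
  have e1 : (((2 * k : ℕ) : ℝ) + 1) / 2 ^ (j + 1) = (2 * k + 1 : ℝ) / 2 ^ (j + 1) := by
    push_cast; ring
  have e2 : (((2 * k : ℕ) : ℝ)) / 2 ^ (j + 1) = (k : ℝ) / 2 ^ j := by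
    push_cast; field_simp; ring
  have e3 : (((2 * k + 1 : ℕ) : ℝ) + 1) / 2 ^ (j + 1) = (k + 1 : ℝ) / 2 ^ j := by
    push_cast; field_simp; ring
  have e4 : (((2 * k + 1 : ℕ) : ℝ)) / 2 ^ (j + 1) = (2 * k + 1 : ℝ) / 2 ^ (j + 1) := by
    push_cast; ring
  rw [e1, e2, e3, e4, pow_succ]
  ring

/-! ### Partial sums of the series against left Riemann sums at dyadic times -/

section Riemann

variable {Ω : Type*} {Φ : ℝ → ℝ} {X W : ℝ → Ω → ℝ} {ω : Ω} {A G α : ℝ}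

/-- Each Haar block is the increment between consecutive dyadic sums. The level `0` sum is the
scaling term because `W 0 = 0`. Since the blocks run over `j = 0, …, J`, the resulting level is `J +
1`. -/
lemma partialZ_eq_dyadicSum (hf : ContinuousOn (fun s => Φ (X s ω)) (Icc 0 1)) (hW : W 0 ω = 0)
    {t : ℝ} (ht : t ∈ Icc (0 : ℝ) 1) (J : ℕ) :
    partialZ Φ X W J t ω =
      dyadicSum (fun x => primitive (fun s => Φ (X s ω)) (min x t)) (fun x => W x ω) (J + 1) := by
  have hblock : ∀ j, dyadicSum (fun x => primitive (fun s => Φ (X s ω)) (min x t))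
      (fun x => W x ω) (j + 1) = dyadicSum (fun x => primitive (fun s => Φ (X s ω)) (min x t))
      (fun x => W x ω) j + blockZ Φ X W j t ω := by
    intro j
    rw [dyadicSum_succ, blockZ]
    congr 1
    refine Finset.sum_congr rfl fun k hk => ?_
    have e : (2 : ℝ) ^ j = (2 : ℝ) ^ ((j : ℝ) / 2) * (2 : ℝ) ^ ((j : ℝ) / 2) := by
      rw [← Real.rpow_add (by norm_num), add_halves, Real.rpow_natCast]
    have e' : ∀ x y : ℝ, (2 : ℝ) ^ j * x * y =
        (2 : ℝ) ^ ((j : ℝ) / 2) * (2 : ℝ) ^ ((j : ℝ) / 2) * x * y := by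
      intro x y; rw [← e]
    rw [coefA_eq hf (Finset.mem_range.1 hk) ht, haarLambda, e']
    ring
  have h0 : dyadicSum (fun x => primitive (fun s => Φ (X s ω)) (min x t)) (fun x => W x ω) 0 =
      coefB Φ X t ω * haarDelta W ω := by
    simp [dyadicSum, coefB_eq hf ht, haarDelta, hW, min_eq_right ht.2, min_eq_left ht.1, primitive]
  have hsum : ∀ n, dyadicSum (fun x => primitive (fun s => Φ (X s ω)) (min x t))
      (fun x => W x ω) n = coefB Φ X t ω * haarDelta W ω +
        ∑ j ∈ Finset.range n, blockZ Φ X W j t ω := by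
    intro n
    induction n with
    | zero => simpa using h0
    | succ n ih => rw [hblock, ih, Finset.sum_range_succ, add_assoc]
  rw [hsum]
  rfl

/-- The left Riemann sum over the dyadic intervals of level `N` contained in `[0, T / 2 ^ N]`. -/
noncomputable def leftSum (Φ : ℝ → ℝ) (X W : ℝ → Ω → ℝ) (N T : ℕ) (ω : Ω) : ℝ :=
  ∑ m ∈ Finset.range T, Φ (X ((m : ℝ) / 2 ^ N) ω) *
    (W ((m + 1 : ℝ) / 2 ^ N) ω - W ((m : ℝ) / 2 ^ N) ω)

/-- At a dyadic time no cell is cut. With `h = 2^{-(J+1)}`, replacing a cell average by the left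
value costs `A h^α`, the increment of `W` is of order `h^{1/2}` up to `√(2 + J)`, and there are at
most `h^{-1}` cells. -/
lemma abs_partialZ_sub_leftSum_le (hα : 0 ≤ α)
    (hf : ContinuousOn (fun s => Φ (X s ω)) (Icc 0 1)) (hW : W 0 ω = 0) (hA0 : 0 ≤ A)
    (hA : ∀ s ∈ Icc (0 : ℝ) 1, ∀ t ∈ Icc (0 : ℝ) 1,
      |Φ (X s ω) - Φ (X t ω)| ≤ A * |s - t| ^ α)
    (hG : ∀ j k : ℕ, k < 2 ^ j →
        (2 : ℝ) ^ ((j : ℝ) / 2) * |W ((k + 1 : ℝ) / 2 ^ j) ω - W ((k : ℝ) / 2 ^ j) ω| ≤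
          G * √(1 + j)) {J T : ℕ} (hT : T ≤ 2 ^ (J + 1)) :
    |partialZ Φ X W J ((T : ℝ) / 2 ^ (J + 1)) ω - leftSum Φ X W (J + 1) T ω| ≤
      A * G * (√(1 + (J + 1 : ℕ)) * (2 : ℝ) ^ (-(((J + 1 : ℕ) : ℝ) * (α - 1 / 2)))) := by
  set N := J + 1 with hN
  set h : ℝ := 1 / 2 ^ N with hh
  have hpos : 0 < h := by positivity
  have hT' : (T : ℝ) ≤ 2 ^ N := by exact_mod_cast hT
  have ht : (T : ℝ) / 2 ^ N ∈ Icc (0 : ℝ) 1 := ⟨by positivity, (div_le_one (by positivity)).2 hT'⟩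
  have hG0 : 0 ≤ G * √(1 + (N : ℝ)) := (mul_nonneg (by positivity) (abs_nonneg _)).trans
    (hG N 0 (by positivity))
  set F := primitive (fun s => Φ (X s ω)) with hF
  have e1 : partialZ Φ X W J ((T : ℝ) / 2 ^ N) ω = ∑ m ∈ Finset.range T,
      2 ^ N * (F ((m + 1 : ℝ) / 2 ^ N) - F ((m : ℝ) / 2 ^ N)) *
        (W ((m + 1 : ℝ) / 2 ^ N) ω - W ((m : ℝ) / 2 ^ N) ω) := by
    rw [partialZ_eq_dyadicSum hf hW ht, dyadicSum]
    symm
    rw [← Finset.sum_subset (Finset.range_mono hT)]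
    · refine Finset.sum_congr rfl fun m hm => ?_
      have hm' : (m : ℝ) + 1 ≤ T := by exact_mod_cast Finset.mem_range.1 hm
      rw [min_eq_left (by gcongr), min_eq_left (div_le_div_of_nonneg_right (by linarith)
        (by positivity))]
    · intro m _ hm
      have hm' : (T : ℝ) ≤ m := by exact_mod_cast not_lt.1 (fun h => hm (Finset.mem_range.2 h))
      rw [min_eq_right (by gcongr; linarith), min_eq_right (by gcongr)]
      simp
  have hr : (2 : ℝ) ^ ((N : ℝ) / 2) = h ^ (-(1 / 2) : ℝ) := two_rpow_natCast_half N
  have hterm : ∀ m ∈ Finset.range T,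
      |2 ^ N * (F ((m + 1 : ℝ) / 2 ^ N) - F ((m : ℝ) / 2 ^ N)) *
        (W ((m + 1 : ℝ) / 2 ^ N) ω - W ((m : ℝ) / 2 ^ N) ω) -
        Φ (X ((m : ℝ) / 2 ^ N) ω) * (W ((m + 1 : ℝ) / 2 ^ N) ω - W ((m : ℝ) / 2 ^ N) ω)| ≤
      A * h ^ α * (h ^ (1 / 2 : ℝ) * (G * √(1 + N))) := by
    intro m hm
    have hm1 : m < 2 ^ N := (Finset.mem_range.1 hm).trans_le hT
    have hm2 : (m : ℝ) + 1 ≤ 2 ^ N := by exact_mod_cast hm1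
    have hmh : (m + 1 : ℝ) / 2 ^ N = (m : ℝ) / 2 ^ N + h := by rw [hh]; ring
    have b1 := abs_primitive_sub_left_le hα hf hA0 hA (x := (m : ℝ) / 2 ^ N) (h := h)
      (by positivity) hpos.le (by rw [← hmh]; exact (div_le_one (by positivity)).2 hm2)
    have b2 : |2 ^ N * (F ((m + 1 : ℝ) / 2 ^ N) - F ((m : ℝ) / 2 ^ N)) -
        Φ (X ((m : ℝ) / 2 ^ N) ω)| ≤ A * h ^ α := by
      have : 2 ^ N * (F ((m + 1 : ℝ) / 2 ^ N) - F ((m : ℝ) / 2 ^ N)) - Φ (X ((m : ℝ) / 2 ^ N) ω) =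
          h⁻¹ * (F ((m : ℝ) / 2 ^ N + h) - F ((m : ℝ) / 2 ^ N) - h * Φ (X ((m : ℝ) / 2 ^ N) ω)) := by
        rw [hmh, mul_sub h⁻¹, inv_mul_cancel_left₀ hpos.ne', hh, one_div, inv_inv]
      rw [this, abs_mul, abs_of_pos (inv_pos.2 hpos), inv_mul_le_iff₀ hpos]
      linarith
    have b3 : |W ((m + 1 : ℝ) / 2 ^ N) ω - W ((m : ℝ) / 2 ^ N) ω| ≤
        h ^ (1 / 2 : ℝ) * (G * √(1 + N)) := by
      have := hG N m hm1
      rwa [hr, Real.rpow_neg hpos.le, inv_mul_le_iff₀ (by positivity)] at this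
    rw [← sub_mul, abs_mul]
    exact mul_le_mul b2 b3 (abs_nonneg _) (by positivity)
  rw [e1, leftSum, ← Finset.sum_sub_distrib]
  refine (Finset.abs_sum_le_sum_abs _ _).trans ((Finset.sum_le_sum hterm).trans ?_)
  rw [Finset.sum_const, Finset.card_range, nsmul_eq_mul]
  have hTh : (T : ℝ) ≤ h ^ (-1 : ℝ) := by
    rw [Real.rpow_neg_one, hh, one_div, inv_inv]; exact hT'
  have hpow : (2 : ℝ) ^ (-((N : ℝ) * (α - 1 / 2))) = h ^ (-1 : ℝ) * (h ^ α * h ^ (1 / 2 : ℝ)) := by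
    rw [← Real.rpow_add hpos, ← Real.rpow_add hpos, two_rpow_neg_natCast_mul]
    congr 1
    ring
  calc (T : ℝ) * (A * h ^ α * (h ^ (1 / 2 : ℝ) * (G * √(1 + N))))
      ≤ h ^ (-1 : ℝ) * (A * h ^ α * (h ^ (1 / 2 : ℝ) * (G * √(1 + N)))) :=
        mul_le_mul_of_nonneg_right hTh (by positivity)
    _ = A * G * (√(1 + N) * (h ^ (-1 : ℝ) * (h ^ α * h ^ (1 / 2 : ℝ)))) := by ring
    _ = _ := by rw [hpow]

end Riemann

end HaarVol

namespace HaarVol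

/-! ### Independence of the past and the increments -/

/-- The sets `A ∩ B` form a π-system generating `m₀ ⊔ m₁`, on which `P (A ∩ B ∩ C) = P A * P (B ∩ C)
= P A * P B * P C`. -/
lemma Indep.sup_left_of_indep_sup {Ω : Type*} {m₀ m₁ m₂ m₁₂ mΩ : MeasurableSpace Ω}
    {P : Measure Ω} [IsProbabilityMeasure P] (h₀ : m₀ ≤ mΩ) (h₁₂ : m₁₂ ≤ mΩ) (h1 : m₁ ≤ m₁₂)
    (h2 : m₂ ≤ m₁₂) (hi : Indep m₀ m₁₂ P) (hi' : Indep m₁ m₂ P) : Indep (m₀ ⊔ m₁) m₂ P := by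
  set π : Set (Set Ω) := {s | ∃ A B, MeasurableSet[m₀] A ∧ MeasurableSet[m₁] B ∧ s = A ∩ B} with hπ
  have hgen : m₀ ⊔ m₁ = MeasurableSpace.generateFrom π := by
    apply le_antisymm
    · refine sup_le (fun s hs => ?_) (fun s hs => ?_)
      · exact MeasurableSpace.measurableSet_generateFrom
          ⟨s, univ, hs, @MeasurableSet.univ _ m₁, by simp⟩
      · exact MeasurableSpace.measurableSet_generateFrom
          ⟨univ, s, @MeasurableSet.univ _ m₀, hs, by simp⟩
    · refine MeasurableSpace.generateFrom_le ?_
      rintro s ⟨A, B, hA, hB, rfl⟩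
      exact @MeasurableSet.inter _ (m₀ ⊔ m₁) _ _ ((le_sup_left : m₀ ≤ m₀ ⊔ m₁) _ hA)
        ((le_sup_right : m₁ ≤ m₀ ⊔ m₁) _ hB)
  have hpi : IsPiSystem π := by
    rintro _ ⟨A, B, hA, hB, rfl⟩ _ ⟨A', B', hA', hB', rfl⟩ _
    exact ⟨A ∩ A', B ∩ B', @MeasurableSet.inter _ m₀ _ _ hA hA',
      @MeasurableSet.inter _ m₁ _ _ hB hB', inter_inter_inter_comm _ _ _ _⟩
  refine IndepSets.indep (p1 := π) (p2 := {s | MeasurableSet[m₂] s}) (sup_le h₀ (h1.trans h₁₂))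
    (h2.trans h₁₂) hpi (@MeasurableSpace.isPiSystem_measurableSet _ m₂) hgen
    (@MeasurableSpace.generateFrom_measurableSet _ m₂).symm ?_
  rw [IndepSets_iff]
  rintro _ C ⟨A, B, hA, hB, rfl⟩ hC
  rw [Indep_iff] at hi hi'
  have hC' : MeasurableSet[m₂] C := hC
  rw [inter_assoc, hi A (B ∩ C) hA (@MeasurableSet.inter _ m₁₂ _ _ (h1 _ hB) (h2 _ hC')),
    hi' B C hB hC', hi A B hA (h1 _ hB), mul_assoc]

lemma volFiltration_mono {Ω : Type*} (X W : ℝ → Ω → ℝ) : Monotone (volFiltration X W) := by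
  intro s t hst
  refine sup_le_sup_left ?_ _
  exact biSup_mono fun u hu => ⟨hu.1, hu.2.trans hst⟩

section Filtration

variable {Ω : Type*} [MeasurableSpace Ω] {P : Measure Ω} {W X : ℝ → Ω → ℝ}

lemma IsBrownianUnit.isGaussianProcess (hW : IsBrownianUnit P W) :
    IsGaussianProcess (fun (t : Icc (0 : ℝ) 1) ω => W t ω) P := by
  refine hW.indep_increments.isGaussianProcess (fun t => ?_) hW.zero
  have h := (hW.law_increment 0 t le_rfl t.2.1 t.2.2).hasGaussianLaw
  refine h.congr ?_
  filter_upwards [hW.zero] with ω hω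
  simp [hω]

/-- Joint Gaussianity reduces independence from the whole past to zero covariance with each `W u`.
This follows from writing the increment as `(W b - W u) - (W a - W u)`. -/
lemma IsBrownianUnit.indepFun_past_increment (hW : IsBrownianUnit P W) {a b : ℝ} (ha : 0 ≤ a)
    (hab : a ≤ b) (hb : b ≤ 1) :
    IndepFun (fun ω (u : {u : Icc (0 : ℝ) 1 // (u : ℝ) ≤ a}) => W u ω)
      (fun ω => W b ω - W a ω) P := by
  have hG := hW.isGaussianProcess
  have hP := hG.isProbabilityMeasure
  set a' : Icc (0 : ℝ) 1 := ⟨a, ha, hab.trans hb⟩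
  set b' : Icc (0 : ℝ) 1 := ⟨b, ha.trans hab, hb⟩
  have hm : ∀ u : Icc (0 : ℝ) 1, AEMeasurable (W u) P := fun u => (hW.measurable u u.2).aemeasurable
  have h := IsGaussianProcess.indepFun_of_covariance_eq_zero (P := P)
    (X := fun (u : {u : Icc (0 : ℝ) 1 // (u : ℝ) ≤ a}) ω => W u ω)
    (Y := fun (_ : Unit) ω => W b ω - W a ω) ?_ (fun u => hm u.1)
    (fun _ => (hm b').sub (hm a')) ?_
  · exact h.comp measurable_id (measurable_pi_apply ())
  · classical
    refine hG.of_isGaussianProcess fun s => ?_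
    rcases s with u | _
    · exact ⟨{u.1}, ContinuousLinearMap.proj ⟨u.1, by simp⟩, fun ω => by simp⟩
    · exact ⟨{b', a'}, ContinuousLinearMap.proj ⟨b', by simp⟩ -
        ContinuousLinearMap.proj ⟨a', by simp⟩, fun ω => by simp [a', b']⟩
  · intro u _
    have hind := hW.indep_increments.indepFun_eval_sub (r := ⊥) (s := u.1) (t := a')
      bot_le u.2 hW.zero
    have hind' := hW.indep_increments.indepFun_eval_sub (r := ⊥) (s := u.1) (t := b')
      bot_le (show u.1 ≤ b' from u.2.trans hab) hW.zero
    have hLp : ∀ t : Icc (0 : ℝ) 1, MemLp (W t) 2 P := fun t =>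
      (hG.hasGaussianLaw_eval t).memLp_two
    have e : (fun ω => W b ω - W a ω) = (W b' - W u.1) - (W a' - W u.1) := by
      ext ω; simp [a', b']
    change cov[W u.1, fun ω => W b ω - W a ω; P] = 0
    rw [e, covariance_sub_right (hLp _) ((hLp _).sub (hLp _)) ((hLp _).sub (hLp _))]
    have c1 := hind.covariance_eq_zero (hLp _) ((hLp _).sub (hLp _))
    have c2 := hind'.covariance_eq_zero (hLp _) ((hLp _).sub (hLp _))
    change cov[W u.1, W a' - W u.1; P] = 0 at c1
    change cov[W u.1, W b' - W u.1; P] = 0 at c2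
    rw [c1, c2, sub_zero]

/-- `W` is a Brownian motion on `[0, 1]` with respect to the filtration `𝓕`. -/
structure IsBrownianWrt (P : Measure Ω) (𝓕 : ℝ → MeasurableSpace Ω) (W : ℝ → Ω → ℝ) : Prop where
  le : ∀ t ∈ Icc (0 : ℝ) 1, 𝓕 t ≤ ‹MeasurableSpace Ω›
  mono : Monotone 𝓕
  adapted : ∀ t ∈ Icc (0 : ℝ) 1, Measurable[𝓕 t] (W t)
  indep : ∀ s t : ℝ, 0 ≤ s → s ≤ t → t ≤ 1 →
    Indep (𝓕 s) (MeasurableSpace.comap (fun ω => W t ω - W s ω) inferInstance) P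
  law : ∀ s t : ℝ, 0 ≤ s → s ≤ t → t ≤ 1 →
    HasLaw (fun ω => W t ω - W s ω) (gaussianReal 0 (t - s).toNNReal) P

/-- Independence of `X` and `W` allows all of `X` to be known from time `0` without spoiling the
independence of future increments of `W`. -/
lemma IsBrownianUnit.isBrownianWrt [IsProbabilityMeasure P] (hW : IsBrownianUnit P W)
    (hX : ∀ s ∈ Icc (0 : ℝ) 1, Measurable (X s))
    (hXW : IndepFun (fun ω (s : Icc (0 : ℝ) 1) => X s ω) (fun ω (s : Icc (0 : ℝ) 1) => W s ω) P) :
    IsBrownianWrt P (volFiltration X W) W where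
  le t ht := sup_le (iSup₂_le fun s hs => (hX s hs).comap_le)
    (iSup₂_le fun u hu => (hW.measurable u ⟨hu.1, hu.2.trans ht.2⟩).comap_le)
  mono := volFiltration_mono X W
  adapted t ht := measurable_iff_comap_le.2
    (le_sup_of_le_right (le_iSup₂_of_le t ⟨ht.1, le_rfl⟩ le_rfl))
  law := hW.law_increment
  indep s t hs hst ht := by
    have hmX : Measurable (fun ω (s : Icc (0 : ℝ) 1) => X s ω) :=
      measurable_pi_lambda _ fun s => hX s s.2
    have hmW : Measurable (fun ω (s : Icc (0 : ℝ) 1) => W s ω) :=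
      measurable_pi_lambda _ fun s => hW.measurable s s.2
    refine indep_of_indep_of_le_left (Indep.sup_left_of_indep_sup
      (m₀ := MeasurableSpace.comap (fun ω (s : Icc (0 : ℝ) 1) => X s ω) inferInstance)
      (m₁ := MeasurableSpace.comap (fun ω (u : {u : Icc (0 : ℝ) 1 // (u : ℝ) ≤ s}) => W u ω)
        inferInstance)
      (m₁₂ := MeasurableSpace.comap (fun ω (s : Icc (0 : ℝ) 1) => W s ω) inferInstance)
      hmX.comap_le hmW.comap_le ?_ ?_ hXW (hW.indepFun_past_increment hs hst ht)) ?_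
    · refine Measurable.comap_le ?_
      exact (measurable_pi_lambda (fun (w : Icc (0 : ℝ) 1 → ℝ)
        (u : {u : Icc (0 : ℝ) 1 // (u : ℝ) ≤ s}) => w u.1) fun u => measurable_pi_apply u.1).comp
        (comap_measurable fun ω (s : Icc (0 : ℝ) 1) => W s ω)
    · refine Measurable.comap_le ?_
      exact ((measurable_pi_apply (⟨t, hs.trans hst, ht⟩ : Icc (0 : ℝ) 1)).sub
        (measurable_pi_apply (⟨s, hs, hst.trans ht⟩ : Icc (0 : ℝ) 1))).comp
        (comap_measurable fun ω (s : Icc (0 : ℝ) 1) => W s ω)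
    · refine sup_le_sup (iSup₂_le fun r hr => ?_) (iSup₂_le fun u hu => ?_)
      · refine Measurable.comap_le ?_
        exact (measurable_pi_apply (⟨r, hr⟩ : Icc (0 : ℝ) 1)).comp
          (comap_measurable fun ω (s : Icc (0 : ℝ) 1) => X s ω)
      · refine Measurable.comap_le ?_
        exact (measurable_pi_apply (⟨⟨u, hu.1, hu.2.trans (hst.trans ht)⟩, hu.2⟩ :
          {u : Icc (0 : ℝ) 1 // (u : ℝ) ≤ s})).comp
          (comap_measurable fun ω (u : {u : Icc (0 : ℝ) 1 // (u : ℝ) ≤ s}) => W u ω)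

end Filtration

/-! ### The Itô isometry for elementary integrands -/

section Isometry

variable {Ω : Type*} [MeasurableSpace Ω] {P : Measure Ω} {W : ℝ → Ω → ℝ} {𝓕 : ℝ → MeasurableSpace Ω}

namespace IsBrownianWrt

variable {Y ξ η : Ω → ℝ} {a b c d : ℝ}

lemma measurable_sub (hW : IsBrownianWrt P 𝓕 W) (ha : 0 ≤ a) (hab : a ≤ b) (hb : b ≤ 1) :
    Measurable[𝓕 b] (fun ω => W b ω - W a ω) :=
  Measurable.fun_sub (hW.adapted b ⟨ha.trans hab, hb⟩)
    ((hW.adapted a ⟨ha, hab.trans hb⟩).mono (hW.mono hab) le_rfl)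

lemma indepFun (hW : IsBrownianWrt P 𝓕 W) (ha : 0 ≤ a) (hab : a ≤ b) (hb : b ≤ 1)
    (hY : Measurable[𝓕 a] Y) : IndepFun Y (fun ω => W b ω - W a ω) P :=
  indep_of_indep_of_le_left (hW.indep a b ha hab hb) hY.comap_le

lemma aestronglyMeasurable (hW : IsBrownianWrt P 𝓕 W) (ha : a ∈ Icc (0 : ℝ) 1)
    (hY : Measurable[𝓕 a] Y) : AEStronglyMeasurable Y P :=
  (hY.mono (hW.le a ha) le_rfl).aestronglyMeasurable

lemma memLp_sub (hW : IsBrownianWrt P 𝓕 W) (ha : 0 ≤ a) (hab : a ≤ b) (hb : b ≤ 1) :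
    MemLp (fun ω => W b ω - W a ω) 2 P :=
  (hW.law a b ha hab hb).hasGaussianLaw.memLp_two

lemma integral_mul_sub (hW : IsBrownianWrt P 𝓕 W) (ha : 0 ≤ a) (hab : a ≤ b) (hb : b ≤ 1)
    (hY : Measurable[𝓕 a] Y) : ∫ ω, Y ω * (W b ω - W a ω) ∂P = 0 := by
  have h := (hW.indepFun ha hab hb hY).integral_fun_mul_eq_mul_integral
    (hW.aestronglyMeasurable ⟨ha, hab.trans hb⟩ hY)
    (hW.memLp_sub ha hab hb).aestronglyMeasurable
  rw [h, (hW.law a b ha hab hb).integral_eq, integral_id_gaussianReal, mul_zero]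

lemma integral_mul_sub_sq (hW : IsBrownianWrt P 𝓕 W) (ha : 0 ≤ a) (hab : a ≤ b) (hb : b ≤ 1)
    (hY : Measurable[𝓕 a] Y) :
    ∫ ω, Y ω * (W b ω - W a ω) ^ 2 ∂P = (∫ ω, Y ω ∂P) * (b - a) := by
  have hind : IndepFun Y (fun ω => (W b ω - W a ω) ^ 2) P :=
    (hW.indepFun ha hab hb hY).comp measurable_id (measurable_id.pow_const 2)
  have h := hind.integral_fun_mul_eq_mul_integral
    (hW.aestronglyMeasurable ⟨ha, hab.trans hb⟩ hY)
    (hW.memLp_sub ha hab hb).integrable_sq.aestronglyMeasurable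
  rw [h]
  congr 1
  have hlaw := hW.law a b ha hab hb
  have h0 : ∫ ω, (W b ω - W a ω) ∂P = 0 := by
    rw [hlaw.integral_eq, integral_id_gaussianReal]
  have hv := hlaw.variance_eq
  rw [variance_id_gaussianReal, variance_of_integral_eq_zero hlaw.aemeasurable h0,
    Real.coe_toNNReal _ (sub_nonneg.2 hab)] at hv
  exact hv

lemma memLp_mul_sub (hW : IsBrownianWrt P 𝓕 W) (ha : 0 ≤ a) (hab : a ≤ b) (hb : b ≤ 1)
    (hξ : Measurable[𝓕 a] ξ) (hξ2 : MemLp ξ 2 P) :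
    MemLp (fun ω => ξ ω * (W b ω - W a ω)) 2 P := by
  have hm := hW.memLp_sub ha hab hb
  rw [memLp_two_iff_integrable_sq (hξ2.aestronglyMeasurable.fun_mul hm.aestronglyMeasurable)]
  have hind : IndepFun (fun ω => ξ ω ^ 2) (fun ω => (W b ω - W a ω) ^ 2) P :=
    (hW.indepFun ha hab hb hξ).comp (measurable_id.pow_const 2) (measurable_id.pow_const 2)
  have := hind.integrable_mul hξ2.integrable_sq hm.integrable_sq
  refine this.congr (ae_of_all _ fun ω => ?_)
  simp [mul_pow]

/-- Allowing arbitrary overlaps avoids a common refinement when a simple process is compared with a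
Riemann sum. The part of `(a, b]` before `c`, and the part of the longer interval after the overlap,
are orthogonal to the rest; only `(c, min b d]` survives. -/
lemma integral_mul_sub_mul_sub_of_le (hW : IsBrownianWrt P 𝓕 W) (ha : 0 ≤ a) (hab : a ≤ b)
    (hb : b ≤ 1) (hac : a ≤ c) (hcd : c ≤ d) (hd : d ≤ 1) (hξ : Measurable[𝓕 a] ξ)
    (hξ2 : MemLp ξ 2 P) (hη : Measurable[𝓕 c] η) (hη2 : MemLp η 2 P) :
    ∫ ω, (ξ ω * (W b ω - W a ω)) * (η ω * (W d ω - W c ω)) ∂P =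
      (∫ ω, ξ ω * η ω ∂P) * max 0 (min b d - c) := by
  have hc : 0 ≤ c := ha.trans hac
  have hξc : Measurable[𝓕 c] ξ := hξ.mono (hW.mono hac) le_rfl
  have hξη : Measurable[𝓕 c] (fun ω => ξ ω * η ω) := Measurable.fun_mul hξc hη
  rcases le_or_gt b c with hbc | hbc
  · rw [max_eq_left (by linarith [min_le_left b d]), mul_zero]
    have hY : Measurable[𝓕 c] (fun ω => ξ ω * η ω * (W b ω - W a ω)) :=
      Measurable.fun_mul hξη ((hW.measurable_sub ha hab hb).mono (hW.mono hbc) le_rfl)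
    rw [← hW.integral_mul_sub hc hcd hd hY]
    congr 1
    ext ω
    ring
  · set e := min b d with he
    set f := max b d with hf
    have hce : c ≤ e := le_min hbc.le hcd
    have hef : e ≤ f := min_le_max
    have hf1 : f ≤ 1 := max_le hb hd
    have he1 : e ≤ 1 := hef.trans hf1
    rw [max_eq_right (by linarith)]
    -- Both coefficients are known at time `c`, so the two increments starting at `c` may be
    -- exchanged and one may assume that the first one is the shorter.
    have hprod : ∀ ω, (W b ω - W c ω) * (W d ω - W c ω) = (W e ω - W c ω) * (W f ω - W c ω) := by
      intro ω
      rcases le_total b d with h | h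
      · rw [he, hf, min_eq_left h, max_eq_right h]
      · rw [he, hf, min_eq_right h, max_eq_left h, mul_comm]
    have i1 : Integrable (fun ω => (ξ ω * (W c ω - W a ω)) * (η ω * (W d ω - W c ω))) P :=
      (hW.memLp_mul_sub ha hac (hcd.trans hd) hξ hξ2).integrable_mul
        (hW.memLp_mul_sub hc hcd hd hη hη2)
    have i2 : Integrable (fun ω => (ξ ω * (W e ω - W c ω)) * (η ω * (W e ω - W c ω))) P :=
      (hW.memLp_mul_sub hc hce he1 hξc hξ2).integrable_mul (hW.memLp_mul_sub hc hce he1 hη hη2)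
    have hηe : Measurable[𝓕 e] η := hη.mono (hW.mono hce) le_rfl
    have i3 : Integrable (fun ω => (ξ ω * (W e ω - W c ω)) * (η ω * (W f ω - W e ω))) P :=
      (hW.memLp_mul_sub hc hce he1 hξc hξ2).integrable_mul
        (hW.memLp_mul_sub (hc.trans hce) hef hf1 hηe hη2)
    have z1 : ∫ ω, (ξ ω * (W c ω - W a ω)) * (η ω * (W d ω - W c ω)) ∂P = 0 := by
      rw [← hW.integral_mul_sub hc hcd hd (Measurable.fun_mul hξη (hW.measurable_sub ha hac (hcd.trans hd)))]
      congr 1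
      ext ω
      ring
    have z2 : ∫ ω, (ξ ω * (W e ω - W c ω)) * (η ω * (W e ω - W c ω)) ∂P =
        (∫ ω, ξ ω * η ω ∂P) * (e - c) := by
      rw [← hW.integral_mul_sub_sq hc hce he1 hξη]
      congr 1
      ext ω
      ring
    have z3 : ∫ ω, (ξ ω * (W e ω - W c ω)) * (η ω * (W f ω - W e ω)) ∂P = 0 := by
      rw [← hW.integral_mul_sub (hc.trans hce) hef hf1 (Measurable.fun_mul
        (hξη.mono (hW.mono hce) le_rfl) (hW.measurable_sub hc hce he1))]
      congr 1
      ext ω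
      ring
    have hsplit : ∀ ω, (ξ ω * (W b ω - W a ω)) * (η ω * (W d ω - W c ω)) =
        (ξ ω * (W c ω - W a ω)) * (η ω * (W d ω - W c ω)) +
          ((ξ ω * (W e ω - W c ω)) * (η ω * (W e ω - W c ω)) +
            (ξ ω * (W e ω - W c ω)) * (η ω * (W f ω - W e ω))) := by
      intro ω
      linear_combination ξ ω * η ω * hprod ω
    simp_rw [hsplit]
    rw [integral_add i1 (i2.fun_add i3), integral_add i2 i3, z1, z2, z3]
    ring

lemma integral_mul_sub_mul_sub (hW : IsBrownianWrt P 𝓕 W) (ha : 0 ≤ a) (hab : a ≤ b)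
    (hb : b ≤ 1) (hc : 0 ≤ c) (hcd : c ≤ d) (hd : d ≤ 1) (hξ : Measurable[𝓕 a] ξ)
    (hξ2 : MemLp ξ 2 P) (hη : Measurable[𝓕 c] η) (hη2 : MemLp η 2 P) :
    ∫ ω, (ξ ω * (W b ω - W a ω)) * (η ω * (W d ω - W c ω)) ∂P =
      (∫ ω, ξ ω * η ω ∂P) * max 0 (min b d - max a c) := by
  rcases le_total a c with h | h
  · rw [hW.integral_mul_sub_mul_sub_of_le ha hab hb h hcd hd hξ hξ2 hη hη2, max_eq_right h]
  · rw [max_eq_left h, min_comm]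
    have := hW.integral_mul_sub_mul_sub_of_le hc hcd hd h hab hb hη hη2 hξ hξ2
    simp_rw [mul_comm (η _) (ξ _)] at this
    rw [← this]
    congr 1
    ext ω
    ring

end IsBrownianWrt

lemma enorm_sq_eq_ofReal (x : ℝ) : ‖x‖ₑ ^ 2 = ENNReal.ofReal (x ^ 2) := by
  rw [Real.enorm_eq_ofReal_abs, ← ENNReal.ofReal_pow (abs_nonneg x), sq_abs]

lemma integral_sq_sum_indicator {ι : Type*} [Fintype ι] (x a b : ι → ℝ) (ha : ∀ i, 0 ≤ a i)
    (hb : ∀ i, b i ≤ 1) :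
    Integrable (fun s => (∑ i, x i * (Ioc (a i) (b i)).indicator (1 : ℝ → ℝ) s) ^ 2)
      (volume.restrict (Icc (0 : ℝ) 1)) ∧
    ∫ s in Icc (0 : ℝ) 1, (∑ i, x i * (Ioc (a i) (b i)).indicator 1 s) ^ 2 =
      ∑ i, ∑ k, x i * x k * max 0 (min (b i) (b k) - max (a i) (a k)) := by
  have hsq : ∀ s : ℝ, (∑ i, x i * (Ioc (a i) (b i)).indicator (1 : ℝ → ℝ) s) ^ 2 =
      ∑ i, ∑ k, x i * x k *
        (Ioc (max (a i) (a k)) (min (b i) (b k))).indicator (1 : ℝ → ℝ) s := by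
    intro s
    rw [sq, Finset.sum_mul_sum]
    refine Finset.sum_congr rfl fun i _ => Finset.sum_congr rfl fun k _ => ?_
    rw [← Ioc_inter_Ioc, inter_indicator_one]
    simp only [Pi.mul_apply]
    ring
  have hint : ∀ i k, Integrable (fun s => x i * x k *
      (Ioc (max (a i) (a k)) (min (b i) (b k))).indicator (1 : ℝ → ℝ) s)
      (volume.restrict (Icc (0 : ℝ) 1)) := fun i k =>
    ((integrable_const (1 : ℝ)).indicator measurableSet_Ioc).const_mul _
  simp_rw [hsq]
  refine ⟨integrable_finsetSum _ fun i _ => integrable_finsetSum _ fun k _ => hint i k, ?_⟩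
  rw [integral_finsetSum _ fun i _ => integrable_finsetSum _ fun k _ => hint i k]
  refine Finset.sum_congr rfl fun i _ => ?_
  rw [integral_finsetSum _ fun k _ => hint i k]
  refine Finset.sum_congr rfl fun k _ => ?_
  rw [integral_const_mul, integral_indicator_one measurableSet_Ioc, measureReal_restrict_apply
    measurableSet_Ioc, inter_eq_left.2, Real.volume_real_Ioc, max_comm]
  intro s hs
  exact ⟨((ha i).trans (le_max_left _ _)).trans hs.1.le,
    hs.2.trans ((min_le_left _ _).trans (hb i))⟩

lemma lintegral_sq_sum_indicator {ι : Type*} [Fintype ι] (x a b : ι → ℝ) (ha : ∀ i, 0 ≤ a i)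
    (hb : ∀ i, b i ≤ 1) :
    ∫⁻ s in Icc (0 : ℝ) 1, ‖∑ i, x i * (Ioc (a i) (b i)).indicator 1 s‖ₑ ^ 2 =
      ENNReal.ofReal (∑ i, ∑ k, x i * x k * max 0 (min (b i) (b k) - max (a i) (a k))) := by
  obtain ⟨h1, h2⟩ := integral_sq_sum_indicator x a b ha hb
  simp_rw [enorm_sq_eq_ofReal]
  rw [← ofReal_integral_eq_lintegral_ofReal h1 (ae_of_all _ fun s => sq_nonneg _), h2]

/-- **Itô isometry** for elementary integrands with possibly overlapping intervals. -/
theorem IsBrownianWrt.lintegral_sq_sum_eq {ι : Type*} [Fintype ι] (hW : IsBrownianWrt P 𝓕 W)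
    (a b : ι → ℝ) (ξ : ι → Ω → ℝ) (ha : ∀ i, 0 ≤ a i) (hab : ∀ i, a i ≤ b i) (hb : ∀ i, b i ≤ 1)
    (hξ : ∀ i, Measurable[𝓕 (a i)] (ξ i)) (hξ2 : ∀ i, MemLp (ξ i) 2 P) :
    ∫⁻ ω, ‖∑ i, ξ i ω * (W (b i) ω - W (a i) ω)‖ₑ ^ 2 ∂P =
      ∫⁻ ω, (∫⁻ s in Icc (0 : ℝ) 1, ‖∑ i, ξ i ω * (Ioc (a i) (b i)).indicator 1 s‖ₑ ^ 2) ∂P := by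
  have hL : ∀ i, MemLp (fun ω => ξ i ω * (W (b i) ω - W (a i) ω)) 2 P := fun i =>
    hW.memLp_mul_sub (ha i) (hab i) (hb i) (hξ i) (hξ2 i)
  have hI : ∀ i k, Integrable (fun ω => (ξ i ω * (W (b i) ω - W (a i) ω)) *
      (ξ k ω * (W (b k) ω - W (a k) ω))) P := fun i k => (hL i).integrable_mul (hL k)
  have hJ : ∀ i k, Integrable (fun ω => ξ i ω * ξ k ω *
      max 0 (min (b i) (b k) - max (a i) (a k))) P := fun i k =>
    ((hξ2 i).integrable_mul (hξ2 k)).mul_const _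
  simp_rw [fun ω => lintegral_sq_sum_indicator (fun i => ξ i ω) a b ha hb, enorm_sq_eq_ofReal]
  rw [← ofReal_integral_eq_lintegral_ofReal, ← ofReal_integral_eq_lintegral_ofReal]
  · congr 1
    simp_rw [sq, Finset.sum_mul_sum]
    rw [integral_finsetSum _ fun i _ => integrable_finsetSum _ fun k _ => hI i k,
      integral_finsetSum _ fun i _ => integrable_finsetSum _ fun k _ => hJ i k]
    refine Finset.sum_congr rfl fun i _ => ?_
    rw [integral_finsetSum _ fun k _ => hI i k, integral_finsetSum _ fun k _ => hJ i k]
    refine Finset.sum_congr rfl fun k _ => ?_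
    rw [hW.integral_mul_sub_mul_sub (ha i) (hab i) (hb i) (ha k) (hab k) (hb k) (hξ i) (hξ2 i)
      (hξ k) (hξ2 k), integral_mul_const]
  · exact integrable_finsetSum _ fun i _ => integrable_finsetSum _ fun k _ => hJ i k
  · refine ae_of_all _ fun ω => ?_
    simp only [Pi.zero_apply]
    rw [← (integral_sq_sum_indicator (fun i => ξ i ω) a b ha hb).2]
    exact integral_nonneg fun s => sq_nonneg _
  · simp_rw [sq, Finset.sum_mul_sum]
    exact integrable_finsetSum _ fun i _ => integrable_finsetSum _ fun k _ => hI i k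
  · exact ae_of_all _ fun ω => sq_nonneg _

end Isometry

end HaarVol

namespace HaarVol

/-! ### The Itô integral is the limit of the left Riemann sums -/

/-- The time `t` is unrelated to `s`: the whole process `X` belongs to every member of the
filtration. -/
lemma measurable_volFiltration {Ω : Type*} {X W : ℝ → Ω → ℝ} {Φ : ℝ → ℝ}
    (hΦ : Continuous Φ) {s : ℝ} (hs : s ∈ Icc (0 : ℝ) 1) (t : ℝ) :
    Measurable[volFiltration X W t] (fun ω => Φ (X s ω)) := by
  refine hΦ.measurable.comp (measurable_iff_comap_le.2 ?_)
  exact le_sup_of_le_left (le_iSup₂_of_le s hs le_rfl)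

section Ito

variable {Ω : Type*} [MeasurableSpace Ω] {P : Measure Ω} {X W Z : ℝ → Ω → ℝ} {Φ : ℝ → ℝ}
  {A : Ω → ℝ} {α : ℝ}

lemma ofReal_sq_le_of_abs_le_add {x y B : ℝ} (h : |x| ≤ |y| + B) :
    ‖x‖ₑ ^ 2 ≤ 2 * ‖y‖ₑ ^ 2 + 2 * ENNReal.ofReal (B ^ 2) := by
  rw [enorm_sq_eq_ofReal, enorm_sq_eq_ofReal, ← ENNReal.ofReal_ofNat 2,
    ← ENNReal.ofReal_mul (by norm_num), ← ENNReal.ofReal_mul (by norm_num),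
    ← ENNReal.ofReal_add (by positivity) (by positivity)]
  refine ENNReal.ofReal_le_ofReal ?_
  have h1 : x ^ 2 ≤ (|y| + B) ^ 2 := sq_le_sq.2 (h.trans (le_abs_self _))
  nlinarith [sq_nonneg (|y| - B), sq_abs y]

lemma indicator_Ioc_min (p q t s : ℝ) :
    (Ioc (min p t) (min q t)).indicator (1 : ℝ → ℝ) s =
      (Ioc p q).indicator 1 s * (Iic t).indicator 1 s := by
  by_cases hs : s ≤ t
  · rw [indicator_of_mem (show s ∈ Iic t from hs)]
    by_cases h : s ∈ Ioc p q
    · rw [indicator_of_mem h, indicator_of_mem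
        (show s ∈ Ioc (min p t) (min q t) from ⟨min_lt_of_left_lt h.1, le_min h.2 hs⟩)]
      simp
    · rw [indicator_of_notMem h, indicator_of_notMem]
      · simp
      · exact fun h' => h ⟨(min_lt_iff.1 h'.1).resolve_right (not_lt.2 hs),
          h'.2.trans (min_le_left _ _)⟩
  · rw [indicator_of_notMem (show s ∉ Iic t from hs), indicator_of_notMem]
    · simp
    · exact fun h' => hs (h'.2.trans (min_le_right _ _))

lemma exists_dyadic_interval {N T : ℕ} {s : ℝ} (hs : 0 < s) (hsT : s ≤ (T : ℝ) / 2 ^ N) :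
    ∃ m < T, s ∈ Ioc ((m : ℝ) / 2 ^ N) ((m + 1 : ℝ) / 2 ^ N) ∧ ∀ x : ℕ → ℝ,
      ∑ k ∈ Finset.range T, x k * (Ioc ((k : ℝ) / 2 ^ N) ((k + 1 : ℝ) / 2 ^ N)).indicator 1 s =
        x m := by
  have hp : (0 : ℝ) < 2 ^ N := by positivity
  have hs' : 0 < s * 2 ^ N := by positivity
  have hc : 0 < ⌈s * 2 ^ N⌉₊ := Nat.ceil_pos.2 hs'
  obtain ⟨m, hm⟩ := Nat.exists_eq_succ_of_ne_zero hc.ne'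
  have hmem : ∀ k : ℕ, s ∈ Ioc ((k : ℝ) / 2 ^ N) ((k + 1 : ℝ) / 2 ^ N) ↔ k = m := by
    intro k
    rw [mem_Ioc, div_lt_iff₀ hp, le_div_iff₀ hp]
    constructor
    · rintro ⟨h1, h2⟩
      have := (Nat.ceil_eq_iff (a := s * 2 ^ N) (n := k + 1) (by simp)).2
        ⟨by simpa using h1, by simpa using h2⟩
      omega
    · rintro rfl
      have := (Nat.ceil_eq_iff (a := s * 2 ^ N) (n := k + 1) (by simp)).1 hm
      simpa using this
  have hmT : m < T := by
    have : ⌈s * 2 ^ N⌉₊ ≤ T := Nat.ceil_le.2 ((le_div_iff₀ hp).1 hsT)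
    omega
  refine ⟨m, hmT, (hmem m).2 rfl, fun x => ?_⟩
  rw [Finset.sum_eq_single m]
  · rw [indicator_of_mem ((hmem m).2 rfl)]
    simp
  · intro k _ hk
    rw [indicator_of_notMem (fun h => hk ((hmem k).1 h)), mul_zero]
  · exact fun h => absurd (Finset.mem_range.2 hmT) h

lemma dyadic_mem_Icc {N m : ℕ} (hm : m ≤ 2 ^ N) : (m : ℝ) / 2 ^ N ∈ Icc (0 : ℝ) 1 :=
  ⟨by positivity, (div_le_one (by positivity)).2 (by exact_mod_cast hm)⟩

/-- The difference is one elementary integral, over the stopped intervals of `S` and the dyadic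
cells together, so the isometry applies. Up to time `T / 2^N` its integrand differs from `S.value -
Φ (X s)` by at most `A (2^{-N})^α`, and afterwards it vanishes; the factors `2` come from squaring a
sum. -/
lemma lintegral_sq_integral_sub_leftSum_le [IsProbabilityMeasure P]
    (hW : IsBrownianWrt P (volFiltration X W) W) (hXm : ∀ s ∈ Icc (0 : ℝ) 1, Measurable (X s))
    (hΦ : Continuous Φ) (hα : 0 ≤ α) (hAm : Measurable A) (hA2 : MemLp A 2 P)
    (hA : ∀ᵐ ω ∂P, (∀ s ∈ Icc (0 : ℝ) 1, |Φ (X s ω)| ≤ A ω) ∧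
      ∀ s ∈ Icc (0 : ℝ) 1, ∀ t ∈ Icc (0 : ℝ) 1, |Φ (X s ω) - Φ (X t ω)| ≤ A ω * |s - t| ^ α)
    (S : SimpleProcess P (volFiltration X W)) {N T : ℕ} (hT : T ≤ 2 ^ N) :
    ∫⁻ ω, ‖S.integral W ((T : ℝ) / 2 ^ N) ω - leftSum Φ X W N T ω‖ₑ ^ 2 ∂P ≤
      2 * ∫⁻ ω, (∫⁻ s in Icc (0 : ℝ) 1, ‖S.value s ω - Φ (X s ω)‖ₑ ^ 2) ∂P +
        2 * ∫⁻ ω, ENNReal.ofReal ((A ω * (1 / 2 ^ N) ^ α) ^ 2) ∂P := by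
  set t : ℝ := (T : ℝ) / 2 ^ N with ht
  have ht01 : t ∈ Icc (0 : ℝ) 1 := dyadic_mem_Icc hT
  have hmle : ∀ m : Fin T, (m : ℕ) ≤ 2 ^ N := fun m => m.2.le.trans hT
  set a : Fin S.n ⊕ Fin T → ℝ :=
    Sum.elim (fun i => min (S.time i) t) (fun m => (m : ℕ) / 2 ^ N) with ha
  set b : Fin S.n ⊕ Fin T → ℝ :=
    Sum.elim (fun i => min (S.time (i + 1)) t) (fun m => ((m : ℕ) + 1 : ℝ) / 2 ^ N) with hb
  -- A coefficient whose time exceeds `t` need not be measurable at the stopped time; it multiplies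
  -- a zero increment and is replaced by zero.
  set ξ : Fin S.n ⊕ Fin T → Ω → ℝ :=
    Sum.elim (fun i ω => if S.time i ≤ t then S.coef i ω else 0)
      (fun m ω => -Φ (X ((m : ℕ) / 2 ^ N) ω)) with hξ
  have hiso := hW.lintegral_sq_sum_eq a b ξ
    (by rintro (i | m)
        · exact le_min (S.time_mem i).1 ht01.1
        · exact (dyadic_mem_Icc (hmle m)).1)
    (by rintro (i | m)
        · exact min_le_min_right _ (S.time_mono (Nat.le_succ _))
        · simp only [ha, hb, Sum.elim_inr]; gcongr; linarith)
    (by rintro (i | m)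
        · exact (min_le_right _ _).trans ht01.2
        · have := dyadic_mem_Icc (N := N) (m := m + 1) (m.2.trans_le hT)
          simpa [hb] using this.2)
    (by rintro (i | m)
        · by_cases h : S.time i ≤ t
          · have e : a (Sum.inl i) = S.time i := min_eq_left h
            rw [e]
            simp only [hξ, Sum.elim_inl, h, if_true]
            exact S.coef_measurable i
          · simp only [hξ, Sum.elim_inl, h, if_false]
            exact measurable_const
        · exact (measurable_volFiltration hΦ (dyadic_mem_Icc (hmle m)) _).neg)
    (by rintro (i | m)
        · by_cases h : S.time i ≤ t
          · simpa only [hξ, Sum.elim_inl, h, if_true] using S.coef_memLp i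
          · simp only [hξ, Sum.elim_inl, h, if_false]
            exact MemLp.zero'
        · refine hA2.mono' (hΦ.measurable.comp
            (hXm _ (dyadic_mem_Icc (hmle m)))).neg.aestronglyMeasurable ?_
          filter_upwards [hA] with ω hω
          simpa [hξ] using hω.1 _ (dyadic_mem_Icc (hmle m)))
  have hsum : ∀ ω, ∑ i, ξ i ω * (W (b i) ω - W (a i) ω) =
      S.integral W t ω - leftSum Φ X W N T ω := by
    intro ω
    rw [Fintype.sum_sum_type, SimpleProcess.integral, leftSum, Finset.sum_range, Finset.sum_range,
      sub_eq_add_neg, ← Finset.sum_neg_distrib]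
    congr 1
    · refine Finset.sum_congr rfl fun i _ => ?_
      simp only [hξ, ha, hb, Sum.elim_inl]
      split_ifs with h
      · rfl
      · rw [min_eq_right (not_le.1 h).le,
          min_eq_right ((not_le.1 h).le.trans (S.time_mono (Nat.le_succ _)))]
        simp
    · refine Finset.sum_congr rfl fun m _ => ?_
      simp only [hξ, ha, hb, Sum.elim_inr]
      ring
  have hind : ∀ ω s, ∑ i, ξ i ω * (Ioc (a i) (b i)).indicator 1 s =
      S.value s ω * (Iic t).indicator 1 s - ∑ m ∈ Finset.range T, Φ (X ((m : ℝ) / 2 ^ N) ω) *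
        (Ioc ((m : ℝ) / 2 ^ N) ((m + 1 : ℝ) / 2 ^ N)).indicator 1 s := by
    intro ω s
    rw [Fintype.sum_sum_type, SimpleProcess.value, Finset.sum_range, Finset.sum_range,
      sub_eq_add_neg, ← Finset.sum_neg_distrib, Finset.sum_mul]
    congr 1
    · refine Finset.sum_congr rfl fun i _ => ?_
      simp only [hξ, ha, hb, Sum.elim_inl]
      rw [indicator_Ioc_min]
      split_ifs with h
      · ring
      · by_cases hs : s ≤ t
        · rw [indicator_of_notMem (s := Ioc _ _) (fun h' => h (h'.1.le.trans hs))]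
          simp
        · rw [indicator_of_notMem (show s ∉ Iic t from hs)]
          simp
    · refine Finset.sum_congr rfl fun m _ => ?_
      simp only [hξ, ha, hb, Sum.elim_inr]
      ring
  simp_rw [hsum] at hiso
  rw [hiso]
  have hpt : ∀ᵐ ω ∂P, ∫⁻ s in Icc (0 : ℝ) 1, ‖∑ i, ξ i ω * (Ioc (a i) (b i)).indicator 1 s‖ₑ ^ 2 ≤
      2 * (∫⁻ s in Icc (0 : ℝ) 1, ‖S.value s ω - Φ (X s ω)‖ₑ ^ 2) +
        2 * ENNReal.ofReal ((A ω * (1 / 2 ^ N) ^ α) ^ 2) := by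
    filter_upwards [hA] with ω hω
    have hA0 : 0 ≤ A ω := (abs_nonneg _).trans (hω.1 0 (by simp))
    have hB0 : 0 ≤ A ω * (1 / 2 ^ N) ^ α := by positivity
    calc ∫⁻ s in Icc (0 : ℝ) 1, ‖∑ i, ξ i ω * (Ioc (a i) (b i)).indicator 1 s‖ₑ ^ 2
        ≤ ∫⁻ s in Icc (0 : ℝ) 1, (2 * ‖S.value s ω - Φ (X s ω)‖ₑ ^ 2 +
          2 * ENNReal.ofReal ((A ω * (1 / 2 ^ N) ^ α) ^ 2)) := by
          refine setLIntegral_mono' measurableSet_Icc fun s hs => ofReal_sq_le_of_abs_le_add ?_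
          rw [hind]
          rcases le_or_gt s t with hst | hst
          -- The point `0` belongs to none of the left-open intervals, so both step functions vanish
          -- there.
          · rcases hs.1.eq_or_lt with h0 | h0
            · have hz : ∀ p q : ℝ, 0 ≤ p → (Ioc p q).indicator (1 : ℝ → ℝ) s = 0 := by
                intro p q hp
                rw [indicator_of_notMem]
                exact fun h => by linarith [h.1]
              have h1 : S.value s ω = 0 := by
                simp [SimpleProcess.value, hz _ _ (S.time_mem _).1]
              have h2 : ∀ m : ℕ, (Ioc ((m : ℝ) / 2 ^ N) ((m + 1 : ℝ) / 2 ^ N)).indicator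
                  (1 : ℝ → ℝ) s = 0 := fun m => hz _ _ (by positivity)
              simp only [h1, h2, zero_mul, mul_zero, Finset.sum_const_zero, sub_zero, abs_zero]
              positivity
            · obtain ⟨m, hm, hsm, hx⟩ := exists_dyadic_interval h0 hst
              rw [hx (fun m => Φ (X ((m : ℝ) / 2 ^ N) ω)),
                indicator_of_mem (show s ∈ Iic t from hst), Pi.one_apply, mul_one]
              have h1 := hω.2 s hs _ (dyadic_mem_Icc (hm.le.trans hT))
              have h2 : |s - (m : ℝ) / 2 ^ N| ^ α ≤ (1 / 2 ^ N) ^ α := by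
                refine Real.rpow_le_rpow (abs_nonneg _) ?_ hα
                rw [abs_of_nonneg (by linarith [hsm.1])]
                have := hsm.2
                rw [add_div] at this
                linarith
              have h3 := mul_le_mul_of_nonneg_left h2 hA0
              calc |S.value s ω - Φ (X ((m : ℝ) / 2 ^ N) ω)|
                  = |(S.value s ω - Φ (X s ω)) + (Φ (X s ω) - Φ (X ((m : ℝ) / 2 ^ N) ω))| := by
                    congr 1; ring
                _ ≤ _ := (abs_add_le _ _).trans (by linarith)
          · have h2 : ∀ m ∈ Finset.range T, Φ (X ((m : ℝ) / 2 ^ N) ω) *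
                (Ioc ((m : ℝ) / 2 ^ N) ((m + 1 : ℝ) / 2 ^ N)).indicator (1 : ℝ → ℝ) s = 0 := by
              intro m hm
              have hm' : (m : ℝ) + 1 ≤ T := by exact_mod_cast Finset.mem_range.1 hm
              rw [indicator_of_notMem, mul_zero]
              intro h
              have : (m + 1 : ℝ) / 2 ^ N ≤ t := by rw [ht]; gcongr
              linarith [h.2]
            rw [Finset.sum_eq_zero h2, indicator_of_notMem (show s ∉ Iic t from not_le.2 hst)]
            simp only [mul_zero, sub_zero, abs_zero]
            positivity
      _ = _ := by
          rw [lintegral_add_right _ measurable_const, lintegral_const_mul' _ _ (by simp)]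
          simp
  refine (lintegral_mono_ae hpt).trans (le_of_eq ?_)
  rw [lintegral_add_right _ (by fun_prop), lintegral_const_mul' _ _ (by simp),
    lintegral_const_mul' _ _ (by simp)]

lemma SimpleProcess.aemeasurable_integral {𝓕 : ℝ → MeasurableSpace Ω}
    (hW : ∀ t ∈ Icc (0 : ℝ) 1, Measurable (W t)) (S : SimpleProcess P 𝓕) {t : ℝ}
    (ht : t ∈ Icc (0 : ℝ) 1) : AEMeasurable (S.integral W t) P := by
  unfold SimpleProcess.integral
  have hmin : ∀ i, min (S.time i) t ∈ Icc (0 : ℝ) 1 := fun i =>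
    ⟨le_min (S.time_mem i).1 ht.1, (min_le_right _ _).trans ht.2⟩
  refine Finset.aemeasurable_fun_sum _ fun i _ => ?_
  exact (S.coef_memLp i).aestronglyMeasurable.aemeasurable.mul
    ((hW _ (hmin _)).sub (hW _ (hmin _))).aemeasurable

/-- Along the simple processes that define the Itô integral the first two error terms tend to zero,
leaving the discretization error with the factor `4 = 2 * 2`. -/
lemma lintegral_sq_sub_leftSum_le [IsProbabilityMeasure P]
    (hW : IsBrownianWrt P (volFiltration X W) W) (hWm : ∀ t ∈ Icc (0 : ℝ) 1, Measurable (W t))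
    (hXm : ∀ s ∈ Icc (0 : ℝ) 1, Measurable (X s))
    (hΦ : Continuous Φ) (hα : 0 ≤ α) (hAm : Measurable A) (hA2 : MemLp A 2 P)
    (hA : ∀ᵐ ω ∂P, (∀ s ∈ Icc (0 : ℝ) 1, |Φ (X s ω)| ≤ A ω) ∧
      ∀ s ∈ Icc (0 : ℝ) 1, ∀ t ∈ Icc (0 : ℝ) 1, |Φ (X s ω) - Φ (X t ω)| ≤ A ω * |s - t| ^ α)
    (hZ : IsItoIntegral P (volFiltration X W) W (fun s ω => Φ (X s ω)) Z)
    {N T : ℕ} (hT : T ≤ 2 ^ N) :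
    ∫⁻ ω, ‖Z ((T : ℝ) / 2 ^ N) ω - leftSum Φ X W N T ω‖ₑ ^ 2 ∂P ≤
      4 * ∫⁻ ω, ENNReal.ofReal ((A ω * (1 / 2 ^ N) ^ α) ^ 2) ∂P := by
  obtain ⟨hZm, S, hS1, hS2⟩ := hZ
  have ht := dyadic_mem_Icc hT
  have hlim := ((ENNReal.Tendsto.const_mul (a := 2) (hS2 _ ht) (Or.inr (by simp))).add
    (ENNReal.Tendsto.const_mul (a := 4) hS1 (Or.inr (by simp)))).add_const
    (4 * ∫⁻ ω, ENNReal.ofReal ((A ω * (1 / 2 ^ N) ^ α) ^ 2) ∂P)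
  simp only [mul_zero, zero_add] at hlim
  refine ge_of_tendsto' hlim fun n => ?_
  have hm : AEMeasurable (fun ω => 2 * ‖(S n).integral W ((T : ℝ) / 2 ^ N) ω -
      Z ((T : ℝ) / 2 ^ N) ω‖ₑ ^ 2) P :=
    ((((S n).aemeasurable_integral hWm ht).sub (hZm _ ht)).enorm.pow_const 2).const_mul 2
  calc ∫⁻ ω, ‖Z ((T : ℝ) / 2 ^ N) ω - leftSum Φ X W N T ω‖ₑ ^ 2 ∂P
      ≤ ∫⁻ ω, (2 * ‖(S n).integral W ((T : ℝ) / 2 ^ N) ω - Z ((T : ℝ) / 2 ^ N) ω‖ₑ ^ 2 +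
        2 * ‖(S n).integral W ((T : ℝ) / 2 ^ N) ω - leftSum Φ X W N T ω‖ₑ ^ 2) ∂P := by
        refine lintegral_mono fun ω => ?_
        set x := (S n).integral W ((T : ℝ) / 2 ^ N) ω
        have := ofReal_sq_le_of_abs_le_add (x := Z ((T : ℝ) / 2 ^ N) ω - leftSum Φ X W N T ω)
          (y := x - Z ((T : ℝ) / 2 ^ N) ω) (B := |x - leftSum Φ X W N T ω|) (by
            rw [abs_sub_comm x (Z _ ω)]
            exact abs_sub_le _ _ _)
        rwa [sq_abs, ← enorm_sq_eq_ofReal] at this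
    _ = 2 * ∫⁻ ω, ‖(S n).integral W ((T : ℝ) / 2 ^ N) ω - Z ((T : ℝ) / 2 ^ N) ω‖ₑ ^ 2 ∂P +
        2 * ∫⁻ ω, ‖(S n).integral W ((T : ℝ) / 2 ^ N) ω - leftSum Φ X W N T ω‖ₑ ^ 2 ∂P := by
        rw [lintegral_add_left' hm, lintegral_const_mul' _ _ (by simp),
          lintegral_const_mul' _ _ (by simp)]
    _ ≤ _ := by
        rw [add_assoc]
        refine add_le_add le_rfl ?_
        refine (mul_le_mul_right (lintegral_sq_integral_sub_leftSum_le hW hXm hΦ hα hAm hA2 hA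
          (S n) hT) 2).trans (le_of_eq ?_)
        rw [mul_add, ← mul_assoc, ← mul_assoc]
        norm_num

lemma measurable_leftSum (hWm : ∀ t ∈ Icc (0 : ℝ) 1, Measurable (W t))
    (hXm : ∀ s ∈ Icc (0 : ℝ) 1, Measurable (X s)) (hΦ : Continuous Φ) {N T : ℕ}
    (hT : T ≤ 2 ^ N) : Measurable (leftSum Φ X W N T) := by
  unfold leftSum
  refine Finset.measurable_fun_sum _ fun m hm => ?_
  have hm' := (Finset.mem_range.1 hm).trans_le hT
  have h1 := dyadic_mem_Icc hm'.le
  have h2 := dyadic_mem_Icc (Nat.succ_le_of_lt hm')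
  push_cast at h2
  exact (hΦ.measurable.comp (hXm _ h1)).mul ((hWm _ h2).sub (hWm _ h1))

/-- The squared `L²` errors decay geometrically in `r`. Their sum is therefore integrable, almost
surely finite, and its terms tend to zero; no subsequence is needed. -/
lemma ae_tendsto_leftSum [IsProbabilityMeasure P]
    (hW : IsBrownianWrt P (volFiltration X W) W) (hWm : ∀ t ∈ Icc (0 : ℝ) 1, Measurable (W t))
    (hXm : ∀ s ∈ Icc (0 : ℝ) 1, Measurable (X s))
    (hΦ : Continuous Φ) (hα : 0 < α) (hAm : Measurable A) (hA2 : MemLp A 2 P)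
    (hA : ∀ᵐ ω ∂P, (∀ s ∈ Icc (0 : ℝ) 1, |Φ (X s ω)| ≤ A ω) ∧
      ∀ s ∈ Icc (0 : ℝ) 1, ∀ t ∈ Icc (0 : ℝ) 1, |Φ (X s ω) - Φ (X t ω)| ≤ A ω * |s - t| ^ α)
    (hZ : IsItoIntegral P (volFiltration X W) W (fun s ω => Φ (X s ω)) Z)
    {n p : ℕ} (hp : p ≤ 2 ^ n) :
    ∀ᵐ ω ∂P, Tendsto (fun r => leftSum Φ X W (n + r) (p * 2 ^ r) ω) atTop
      (𝓝 (Z ((p : ℝ) / 2 ^ n) ω)) := by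
  have hT : ∀ r, p * 2 ^ r ≤ 2 ^ (n + r) := fun r => by
    rw [pow_add]; exact Nat.mul_le_mul_right _ hp
  have ht : ∀ r, ((p * 2 ^ r : ℕ) : ℝ) / 2 ^ (n + r) = (p : ℝ) / 2 ^ n := fun r => by
    rw [pow_add]; push_cast; field_simp
  set g : ℕ → Ω → ℝ≥0∞ := fun r ω =>
    ‖Z ((p : ℝ) / 2 ^ n) ω - leftSum Φ X W (n + r) (p * 2 ^ r) ω‖ₑ ^ 2 with hg
  have hgm : ∀ r, AEMeasurable (g r) P := fun r =>
    ((hZ.1 _ (dyadic_mem_Icc hp)).sub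
      (measurable_leftSum hWm hXm hΦ (hT r)).aemeasurable).enorm.pow_const 2
  set q : ℝ := (1 / 2 : ℝ) ^ α with hq
  have hq0 : 0 < q := by positivity
  have hq1 : q < 1 := Real.rpow_lt_one (by norm_num) (by norm_num) hα
  have hpow : ∀ N : ℕ, (1 / 2 ^ N : ℝ) ^ α = q ^ N := fun N => by
    rw [hq, ← one_div_pow, Real.rpow_pow_comm (by norm_num)]
  have hbound : ∀ r, ∫⁻ ω, g r ω ∂P ≤
      4 * (∫⁻ ω, ENNReal.ofReal (A ω ^ 2) ∂P) * ENNReal.ofReal ((q ^ 2) ^ r) := by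
    intro r
    have h := lintegral_sq_sub_leftSum_le hW hWm hXm hΦ hα.le hAm hA2 hA hZ (hT r)
    rw [ht] at h
    refine h.trans ?_
    rw [mul_assoc, ← lintegral_mul_const _ (by fun_prop)]
    refine mul_le_mul_right (lintegral_mono fun ω => ?_) 4
    rw [← ENNReal.ofReal_mul (sq_nonneg _), mul_pow, hpow]
    refine ENNReal.ofReal_le_ofReal (mul_le_mul_of_nonneg_left ?_ (sq_nonneg _))
    rw [← pow_mul, ← pow_mul]
    exact pow_le_pow_of_le_one hq0.le hq1.le (by nlinarith)
  have hfin : ∫⁻ ω, ∑' r, g r ω ∂P ≠ ∞ := by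
    rw [lintegral_tsum hgm]
    refine ne_top_of_le_ne_top ?_ (ENNReal.tsum_le_tsum hbound)
    rw [ENNReal.tsum_mul_left]
    refine ENNReal.mul_ne_top (ENNReal.mul_ne_top (by simp) ?_) ?_
    · have h := hA2.integrable_sq.2
      rw [hasFiniteIntegral_iff_ofReal (ae_of_all _ fun ω => sq_nonneg _)] at h
      exact h.ne
    · refine (Summable.tsum_ofReal_lt_top ?_).ne
      exact summable_geometric_of_lt_one (by positivity) (by nlinarith)
  filter_upwards [ae_lt_top' (AEMeasurable.tsum hgm) hfin] with ω hω
  have h0 := ENNReal.tendsto_atTop_zero_of_tsum_ne_top hω.ne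
  have h1 : Tendsto (fun r => (Z ((p : ℝ) / 2 ^ n) ω -
      leftSum Φ X W (n + r) (p * 2 ^ r) ω) ^ 2) atTop (𝓝 0) := by
    have := (ENNReal.tendsto_toReal (by simp)).comp h0
    refine this.congr fun r => ?_
    simp only [Function.comp, hg]
    rw [enorm_sq_eq_ofReal, ENNReal.toReal_ofReal (sq_nonneg _)]
  have h2 : Tendsto (fun r => Z ((p : ℝ) / 2 ^ n) ω -
      leftSum Φ X W (n + r) (p * 2 ^ r) ω) atTop (𝓝 0) := by
    have := h1.sqrt
    simp only [Real.sqrt_zero, Real.sqrt_sq_eq_abs] at this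
    exact (tendsto_zero_iff_abs_tendsto_zero _).2 this
  simpa using (h2.const_sub (Z ((p : ℝ) / 2 ^ n) ω))

end Ito

end HaarVol

/-! ### Random constants, density of the dyadic points and the remainder of the series -/

namespace HaarVol

section Final

variable {Ω : Type*} {Φ : ℝ → ℝ} {X W : ℝ → Ω → ℝ} {ω : Ω}

/-- A polynomially bounded `C¹` function along a path bounded by `2 M` and with Hölder constant
`M`. -/
lemma abs_comp_le_of_growth {c L α M : ℝ} (hc : 0 < c) (hΦ : ContDiff ℝ 1 Φ)
    (hΦL : ∀ x : ℝ, |Φ x| + |deriv Φ x| ≤ c * (1 + |x|) ^ L) (hM : 0 ≤ M) {x : ℝ → ℝ}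
    (hx : ∀ s ∈ Icc (0 : ℝ) 1, |x s| ≤ 2 * M)
    (hx' : ∀ s ∈ Icc (0 : ℝ) 1, ∀ t ∈ Icc (0 : ℝ) 1, |x s - x t| ≤ M * |s - t| ^ α) :
    (∀ s ∈ Icc (0 : ℝ) 1, |Φ (x s)| ≤ c * (1 + 2 * M) ^ ⌈L⌉₊ * (1 + M)) ∧
      ∀ s ∈ Icc (0 : ℝ) 1, ∀ t ∈ Icc (0 : ℝ) 1,
        |Φ (x s) - Φ (x t)| ≤ c * (1 + 2 * M) ^ ⌈L⌉₊ * (1 + M) * |s - t| ^ α := by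
  -- The exponent is rounded up to an integer so that moments of the bound follow by repeated
  -- multiplication. The later factor `1 + M` covers both the size bound, which needs `1`, and the
  -- Hölder constant, which needs `M`.
  have hB : ∀ y : ℝ, |y| ≤ 2 * M → |Φ y| + |deriv Φ y| ≤ c * (1 + 2 * M) ^ ⌈L⌉₊ := by
    intro y hy
    refine (hΦL y).trans (mul_le_mul_of_nonneg_left ?_ hc.le)
    have h1 : 1 ≤ 1 + |y| := by linarith [abs_nonneg y]
    refine (Real.rpow_le_rpow_of_exponent_le h1 (Nat.le_ceil L)).trans ?_
    rw [Real.rpow_natCast]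
    exact pow_le_pow_left₀ (by positivity) (by linarith) _
  have hB0 : 0 ≤ c * (1 + 2 * M) ^ ⌈L⌉₊ := by positivity
  refine ⟨fun s hs => ?_, fun s hs t ht => ?_⟩
  · nlinarith [hB _ (hx s hs), abs_nonneg (deriv Φ (x s)), abs_nonneg (Φ (x s))]
  · have hd : Differentiable ℝ Φ := hΦ.differentiable (by simp)
    have h := Convex.norm_image_sub_le_of_norm_deriv_le (f := Φ) (s := Icc (-(2 * M)) (2 * M))
      (C := c * (1 + 2 * M) ^ ⌈L⌉₊) (fun y _ => hd y)
      (fun y hy => by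
        have := hB y (abs_le.2 hy)
        rw [Real.norm_eq_abs]
        linarith [abs_nonneg (Φ y)])
      (convex_Icc _ _) (abs_le.1 (hx t ht)) (abs_le.1 (hx s hs))
    simp only [Real.norm_eq_abs] at h
    have h2 := hx' s hs t ht
    have h3 : 0 ≤ |s - t| ^ α := by positivity
    calc |Φ (x s) - Φ (x t)| ≤ c * (1 + 2 * M) ^ ⌈L⌉₊ * (M * |s - t| ^ α) :=
          h.trans (mul_le_mul_of_nonneg_left h2 hB0)
      _ ≤ c * (1 + 2 * M) ^ ⌈L⌉₊ * ((1 + M) * |s - t| ^ α) :=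
          mul_le_mul_of_nonneg_left (mul_le_mul_of_nonneg_right (by linarith) h3) hB0
      _ = _ := by ring

/-- The random Hölder constant of `Φ (X s)` has moments of every order. -/
theorem IsCenteredGaussianUnit.exists_memLp_comp_bound [MeasurableSpace Ω] {P : Measure Ω}
    [IsProbabilityMeasure P] (hX : IsCenteredGaussianUnit P X) {α : ℝ} (hα : 0 < α)
    (hXα : ∀ᵐ ω ∂P, HolderPath α (fun s => X s ω)) {c L : ℝ} (hc : 0 < c) (hΦ : ContDiff ℝ 1 Φ)
    (hΦL : ∀ x : ℝ, |Φ x| + |deriv Φ x| ≤ c * (1 + |x|) ^ L) :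
    ∃ A : Ω → ℝ, Measurable A ∧ (∀ ω, 0 ≤ A ω) ∧ (∀ p : ℝ≥0, MemLp A p P) ∧
      ∀ᵐ ω ∂P, (∀ s ∈ Icc (0 : ℝ) 1, |Φ (X s ω)| ≤ A ω) ∧
        ∀ s ∈ Icc (0 : ℝ) 1, ∀ t ∈ Icc (0 : ℝ) 1,
          |Φ (X s ω) - Φ (X t ω)| ≤ A ω * |s - t| ^ α := by
  obtain ⟨M, hMm, hM0, hMp, hM⟩ := hX.exists_memLp_holder_bound hα hXα
  have h1 : ∀ p : ℝ≥0, MemLp (fun ω => 1 + 2 * M ω) p P := fun p =>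
    MemLp.add (f := fun _ => (1 : ℝ)) (memLp_const 1) ((hMp p).const_mul 2)
  have h2 : ∀ p : ℝ≥0, MemLp (fun ω => c * (1 + 2 * M ω) ^ ⌈L⌉₊) p P := fun p =>
    MemLp.const_mul (memLp_pow_of_forall h1 ⌈L⌉₊ p) c
  have h3 : ∀ p : ℝ≥0, MemLp (fun ω => 1 + M ω) p P := fun p =>
    MemLp.add (f := fun _ => (1 : ℝ)) (memLp_const 1) (hMp p)
  refine ⟨fun ω => c * (1 + 2 * M ω) ^ ⌈L⌉₊ * (1 + M ω), ?_, fun ω => ?_,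
    memLp_mul_of_forall h2 h3, ?_⟩
  · exact (((hMm.const_mul 2).const_add 1).pow_const _ |>.const_mul c).mul (hMm.const_add 1)
  · have := hM0 ω
    positivity
  · filter_upwards [hM] with ω hω
    exact abs_comp_le_of_growth hc hΦ hΦL (hM0 ω) hω.1 hω.2

/-- The variable is the difference of two increments of level `j + 1`, hence the factor `2`. The
loss `√(2 + j) ≤ √2 √(1 + j)` is compensated by the gain `√2` in the normalization. -/
lemma abs_haarLambda_le {G : ℝ} (hG0 : 0 ≤ G)
    (hG : ∀ j k : ℕ, k < 2 ^ j →
      (2 : ℝ) ^ ((j : ℝ) / 2) * |W ((k + 1 : ℝ) / 2 ^ j) ω - W ((k : ℝ) / 2 ^ j) ω| ≤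
        G * √(1 + j)) (j k : ℕ) (hk : k < 2 ^ j) :
    |haarLambda W j k ω| ≤ 2 * G * √(1 + j) := by
  have h1 := hG (j + 1) (2 * k) (by rw [pow_succ]; omega)
  have h2 := hG (j + 1) (2 * k + 1) (by rw [pow_succ]; omega)
  have e2 : (((2 * k : ℕ) : ℝ)) / 2 ^ (j + 1) = (k : ℝ) / 2 ^ j := by
    push_cast; field_simp; ring
  have e3 : (((2 * k + 1 : ℕ) : ℝ) + 1) / 2 ^ (j + 1) = (k + 1 : ℝ) / 2 ^ j := by
    push_cast; field_simp; ring
  rw [e2] at h1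
  rw [e3] at h2
  push_cast at h1 h2
  set r : ℝ := (2 : ℝ) ^ ((j : ℝ) / 2) with hr
  have hr1 : (2 : ℝ) ^ (((j : ℝ) + 1) / 2) = √2 * r := by
    rw [add_div, Real.rpow_add (by norm_num), Real.sqrt_eq_rpow, mul_comm]
  have hs : √(1 + ((j : ℝ) + 1)) ≤ √2 * √(1 + j) := by
    rw [← Real.sqrt_mul (by norm_num)]
    refine Real.sqrt_le_sqrt ?_
    have : (0 : ℝ) ≤ j := by positivity
    linarith
  have h2pos : 0 < √(2 : ℝ) := by positivity
  have key : ∀ y : ℝ, (2 : ℝ) ^ (((j : ℝ) + 1) / 2) * |y| ≤ G * √(1 + ((j : ℝ) + 1)) →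
      r * |y| ≤ G * √(1 + j) := by
    intro y hy
    have : √2 * (r * |y|) ≤ √2 * (G * √(1 + j)) := by
      calc √2 * (r * |y|) = (2 : ℝ) ^ (((j : ℝ) + 1) / 2) * |y| := by rw [hr1]; ring
        _ ≤ G * √(1 + ((j : ℝ) + 1)) := hy
        _ ≤ G * (√2 * √(1 + j)) := mul_le_mul_of_nonneg_left hs hG0
        _ = _ := by ring
    exact le_of_mul_le_mul_left this h2pos
  have k1 := key _ h1
  have k2 := key _ h2
  have e : haarLambda W j k ω =
      r * (W ((2 * k + 1 : ℝ) / 2 ^ (j + 1)) ω - W ((k : ℝ) / 2 ^ j) ω) -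
        r * (W ((k + 1 : ℝ) / 2 ^ j) ω - W ((2 * k + 1 : ℝ) / 2 ^ (j + 1)) ω) := by
    rw [haarLambda]
    ring
  have hr0 : 0 ≤ r := by positivity
  rw [e]
  refine (abs_sub _ _).trans ?_
  rw [abs_mul, abs_mul, abs_of_nonneg hr0]
  linarith

lemma denseRange_dyadic : DenseRange (fun q : Σ n : ℕ, Fin (2 ^ n + 1) =>
    (⟨((q.2 : ℕ) : ℝ) / 2 ^ q.1, dyadic_mem_Icc (Nat.lt_succ_iff.1 q.2.2)⟩ : Icc (0 : ℝ) 1)) := by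
  rw [Metric.denseRange_iff]
  intro x r hr
  obtain ⟨n, hn⟩ := exists_pow_lt_of_lt_one hr (show (1 / 2 : ℝ) < 1 by norm_num)
  have hp : (0 : ℝ) < 2 ^ n := by positivity
  have h0 : 0 ≤ (x : ℝ) * 2 ^ n := mul_nonneg x.2.1 hp.le
  have h1 := Nat.floor_le h0
  have h2 := Nat.lt_floor_add_one ((x : ℝ) * 2 ^ n)
  have hle : ⌊(x : ℝ) * 2 ^ n⌋₊ ≤ 2 ^ n := by
    have : (⌊(x : ℝ) * 2 ^ n⌋₊ : ℝ) ≤ 2 ^ n := h1.trans (by nlinarith [x.2.2])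
    exact_mod_cast this
  refine ⟨⟨n, ⟨⌊(x : ℝ) * 2 ^ n⌋₊, Nat.lt_succ_of_le hle⟩⟩, lt_of_le_of_lt ?_ hn⟩
  rw [Subtype.dist_eq, Real.dist_eq]
  have e : (x : ℝ) = (x : ℝ) * 2 ^ n / 2 ^ n := by field_simp
  have h3 : (x : ℝ) - (⌊(x : ℝ) * 2 ^ n⌋₊ : ℝ) / 2 ^ n =
      ((x : ℝ) * 2 ^ n - ⌊(x : ℝ) * 2 ^ n⌋₊) / 2 ^ n := by
    rw [sub_div, ← e]
  change |(x : ℝ) - (⌊(x : ℝ) * 2 ^ n⌋₊ : ℝ) / 2 ^ n| ≤ _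
  rw [h3, abs_of_nonneg (div_nonneg (by linarith) hp.le), one_div_pow]
  exact div_le_div_of_nonneg_right (by linarith) hp.le

lemma abs_sub_le_of_dyadic {u : ℝ → ℝ} {K γ : ℝ} (hγ : 0 ≤ γ) (hu : ContinuousOn u (Icc 0 1))
    (h : ∀ n p m q : ℕ, p ≤ 2 ^ n → q ≤ 2 ^ m →
      |u ((p : ℝ) / 2 ^ n) - u ((q : ℝ) / 2 ^ m)| ≤ K * |(p : ℝ) / 2 ^ n - (q : ℝ) / 2 ^ m| ^ γ)
    {s t : ℝ} (hs : s ∈ Icc (0 : ℝ) 1) (ht : t ∈ Icc (0 : ℝ) 1) :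
    |u s - u t| ≤ K * |s - t| ^ γ := by
  have hc : Continuous (fun s : Icc (0 : ℝ) 1 => u s) := continuousOn_iff_continuous_domRestrict.1 hu
  suffices ∀ s t : Icc (0 : ℝ) 1, |u s - u t| ≤ K * |(s : ℝ) - t| ^ γ from
    this ⟨s, hs⟩ ⟨t, ht⟩
  refine denseRange_dyadic.induction_on₂ ?_ ?_
  · exact isClosed_le ((hc.comp continuous_fst).sub (hc.comp continuous_snd)).abs
      (continuous_const.mul (Continuous.rpow_const (by fun_prop) fun _ => Or.inr hγ))
  · exact fun a b => h _ _ _ _ (Nat.lt_succ_iff.1 a.2.2) (Nat.lt_succ_iff.1 b.2.2)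

lemma holderNorm_le {γ K : ℝ} (hγ : 0 ≤ γ) (hK : 0 ≤ K) {u : ℝ → ℝ} (hu0 : u 0 = 0)
    (h : ∀ s ∈ Icc (0 : ℝ) 1, ∀ t ∈ Icc (0 : ℝ) 1, |u s - u t| ≤ K * |s - t| ^ γ) :
    holderNorm γ u ≤ ENNReal.ofReal (2 * K) := by
  rw [two_mul, ENNReal.ofReal_add hK hK]
  refine add_le_add (iSup₂_le fun t ht => ENNReal.ofReal_le_ofReal ?_)
    (holderSeminorm_le fun s t h0 hst h1 => h s ⟨h0, by linarith⟩ t ⟨by linarith, h1⟩)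
  have h1 := h t ht 0 (by simp)
  rw [hu0, sub_zero, sub_zero] at h1
  refine h1.trans (mul_le_of_le_one_right hK (Real.rpow_le_one (abs_nonneg _) ?_ hγ))
  rw [abs_of_nonneg ht.1]
  exact ht.2

lemma partialZ_zero (hf : ContinuousOn (fun s => Φ (X s ω)) (Icc 0 1)) (J : ℕ) :
    partialZ Φ X W J 0 ω = 0 := by
  have h0 : (0 : ℝ) ∈ Icc (0 : ℝ) 1 := by simp
  rw [partialZ, coefB_eq hf h0, Finset.sum_eq_zero]
  · simp [primitive]
  · intro j _
    refine Finset.sum_eq_zero fun k hk => ?_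
    obtain ⟨h1, h2, h3, h4⟩ := dyadic_mem (Finset.mem_range.1 hk)
    rw [coefA_eq hf (Finset.mem_range.1 hk) h0, min_eq_right h1, min_eq_right (h1.trans h2),
      min_eq_right ((h1.trans h2).trans h3)]
    simp [primitive]

/-- The uniform bound on the partial sums with `J = 0` makes these terms summable. -/
lemma tendsto_sqrt_mul_two_rpow {β : ℝ} (hβ : 0 < β) :
    Tendsto (fun n : ℕ => √(1 + (n : ℝ)) * (2 : ℝ) ^ (-((n : ℝ) * β))) atTop (𝓝 0) := by
  obtain ⟨κ, -, hκ⟩ := exists_sum_sqrt_mul_two_rpow_le hβ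
  have hs := summable_of_sum_range_le (f := fun i : ℕ =>
    √(1 + ((0 + 1 + i : ℕ) : ℝ)) * (2 : ℝ) ^ (-(((0 + 1 + i : ℕ) : ℝ) * β)))
    (fun i => by positivity) (hκ 0)
  rw [← tendsto_add_atTop_iff_nat 1]
  refine hs.tendsto_atTop_zero.congr fun i => ?_
  rw [show 0 + 1 + i = i + 1 by ring]

/-- If the partial sums converge to `z` at the dyadic points, then the remainder satisfies a
Hölder estimate. -/
lemma abs_sub_partialZ_sub_le {A B α β γ κ : ℝ} (hα : 0 ≤ α)
    (hf : ContinuousOn (fun s => Φ (X s ω)) (Icc 0 1))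
    (hA : ∀ s ∈ Icc (0 : ℝ) 1, |Φ (X s ω)| ≤ A)
    (hA' : ∀ s ∈ Icc (0 : ℝ) 1, ∀ t ∈ Icc (0 : ℝ) 1,
      |Φ (X s ω) - Φ (X t ω)| ≤ A * |s - t| ^ α)
    (hB0 : 0 ≤ B) (hB : ∀ j k : ℕ, k < 2 ^ j → |haarLambda W j k ω| ≤ B * √(1 + j))
    (hγ : 0 ≤ γ) (hγ1 : γ ≤ 1) (hβα : β ≤ α - 1 / 2) (hβγ : β ≤ 1 / 2 - γ)
    (hκ : ∀ J n : ℕ, ∑ i ∈ Finset.range n,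
      √(1 + (J + 1 + i : ℕ)) * (2 : ℝ) ^ (-(((J + 1 + i : ℕ) : ℝ) * β)) ≤
        κ * (2 : ℝ) ^ (-((J : ℝ) * β)) * √(1 + J)) {z : ℝ → ℝ} (hz : ContinuousOn z (Icc 0 1))
    (hlim : ∀ n p : ℕ, p ≤ 2 ^ n → Tendsto (fun J => partialZ Φ X W J ((p : ℝ) / 2 ^ n) ω) atTop
      (𝓝 (z ((p : ℝ) / 2 ^ n)))) (J : ℕ) {s t : ℝ} (hs : s ∈ Icc (0 : ℝ) 1)
    (ht : t ∈ Icc (0 : ℝ) 1) :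
    |(z s - partialZ Φ X W J s ω) - (z t - partialZ Φ X W J t ω)| ≤
      3 * A * B * (κ * (2 : ℝ) ^ (-((J : ℝ) * β)) * √(1 + J)) * |s - t| ^ γ := by
  have hA0 : 0 ≤ A := (abs_nonneg _).trans (hA 0 (by simp))
  have hK0 : 0 ≤ κ * (2 : ℝ) ^ (-((J : ℝ) * β)) * √(1 + J) := by simpa using hκ J 0
  set K := 3 * A * B * (κ * (2 : ℝ) ^ (-((J : ℝ) * β)) * √(1 + J)) with hK
  have hK0' : 0 ≤ K := by positivity
  -- The bound is uniform in the number `n` of added blocks, so it survives the limit `n → ∞`. That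
  -- limit is known only at dyadic points; density and the continuity of `z` do the rest.
  have hlt : ∀ s t : ℝ, 0 ≤ s → s < t → t ≤ 1 → ∀ n : ℕ,
      |(partialZ Φ X W (J + n) t ω - partialZ Φ X W J t ω) -
        (partialZ Φ X W (J + n) s ω - partialZ Φ X W J s ω)| ≤ K * (t - s) ^ γ := by
    intro s t h0 hst h1 n
    have h2 : 0 ≤ (t - s) ^ γ := Real.rpow_nonneg (by linarith) _
    rw [partialZ_add, partialZ_add, add_sub_cancel_left, add_sub_cancel_left,
      ← Finset.sum_sub_distrib]
    calc |∑ i ∈ Finset.range n, (blockZ Φ X W (J + 1 + i) t ω - blockZ Φ X W (J + 1 + i) s ω)|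
        ≤ ∑ i ∈ Finset.range n, 3 * A * B * (√(1 + ((J + 1 + i : ℕ) : ℝ)) *
            (2 : ℝ) ^ (-(((J + 1 + i : ℕ) : ℝ) * β))) * (t - s) ^ γ :=
          (Finset.abs_sum_le_sum_abs _ _).trans (Finset.sum_le_sum fun i _ =>
            abs_blockZ_sub_le hα hf hA hA' hB hγ hγ1 hβα hβγ _ h0 hst h1)
      _ ≤ K * (t - s) ^ γ := by
          rw [← Finset.sum_mul, ← Finset.mul_sum]
          exact mul_le_mul_of_nonneg_right (mul_le_mul_of_nonneg_left (hκ J n) (by positivity)) h2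
  have hsymm : ∀ s ∈ Icc (0 : ℝ) 1, ∀ t ∈ Icc (0 : ℝ) 1, ∀ n : ℕ,
      |(partialZ Φ X W (J + n) s ω - partialZ Φ X W J s ω) -
        (partialZ Φ X W (J + n) t ω - partialZ Φ X W J t ω)| ≤ K * |s - t| ^ γ := by
    intro s hs t ht n
    rcases lt_trichotomy s t with h | h | h
    · rw [abs_sub_comm, abs_sub_comm s t, abs_of_pos (sub_pos.2 h)]
      exact hlt s t hs.1 h ht.2 n
    · rw [h, sub_self, abs_zero]
      positivity
    · rw [abs_of_pos (sub_pos.2 h)]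
      exact hlt t s ht.1 h hs.2 n
  obtain ⟨C, hC⟩ := exists_abs_partialZ_sub_le (W := W) hf J
  obtain ⟨C', hC'⟩ := exists_lipschitzOnWith_of_abs_sub_le hC
  refine abs_sub_le_of_dyadic (u := fun t => z t - partialZ Φ X W J t ω) hγ
    (hz.sub hC'.continuousOn) (fun n p m q hp hq => ?_) hs ht
  have h1 : ∀ n p : ℕ, p ≤ 2 ^ n → Tendsto (fun i => partialZ Φ X W (J + i) ((p : ℝ) / 2 ^ n) ω -
      partialZ Φ X W J ((p : ℝ) / 2 ^ n) ω) atTop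
      (𝓝 (z ((p : ℝ) / 2 ^ n) - partialZ Φ X W J ((p : ℝ) / 2 ^ n) ω)) := by
    intro n p hp
    have := (tendsto_add_atTop_iff_nat J).2 (hlim n p hp)
    simp_rw [add_comm _ J] at this
    exact this.sub_const _
  exact le_of_tendsto' ((h1 n p hp).sub (h1 m q hq)).abs fun i =>
    hsymm _ (dyadic_mem_Icc hp) _ (dyadic_mem_Icc hq) i

end Final

end HaarVol

/-! ### The approximation theorem -/

theorem theorem3 {Ω : Type*} [MeasurableSpace Ω] (P : Measure Ω) [IsProbabilityMeasure P]
    (X W Z : ℝ → Ω → ℝ) (Φ : ℝ → ℝ) (α c L : ℝ)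
    (hα : 1 / 2 < α) (hα' : α ≤ 1)
    (hX : HaarVol.IsCenteredGaussianUnit P X)
    (hXα : ∀ᵐ ω ∂P, HaarVol.HolderPath α (fun s => X s ω))
    (hc : 0 < c) (hL : 0 < L)
    (hΦ : ContDiff ℝ 1 Φ)
    (hΦL : ∀ x : ℝ, |Φ x| + |deriv Φ x| ≤ c * (1 + |x|) ^ L)
    (hW : HaarVol.IsBrownianUnit P W)
    (hXW : IndepFun (fun ω (s : Icc (0 : ℝ) 1) => X s ω) (fun ω (s : Icc (0 : ℝ) 1) => W s ω) P)
    (hZ : HaarVol.IsItoIntegral P (HaarVol.volFiltration X W) W (fun s ω => Φ (X s ω)) Z)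
    (hZc : ∀ᵐ ω ∂P, ContinuousOn (fun t => Z t ω) (Icc 0 1))
    (γ : ℝ) (hγ : 0 ≤ γ) (hγ' : γ < 1 / 2) :
    (∀ ω, HaarVol.HolderPath α (fun s => X s ω) →
      (∃ K : ℝ≥0, LipschitzOnWith K (fun t => HaarVol.coefB Φ X t ω) (Icc 0 1)) ∧
      (∀ j k : ℕ, k < 2 ^ j →
        ∃ K : ℝ≥0, LipschitzOnWith K (fun t => HaarVol.coefA Φ X j k t ω) (Icc 0 1)) ∧
      ∀ J : ℕ,
        (∃ K : ℝ≥0, LipschitzOnWith K (fun t => HaarVol.partialZ Φ X W J t ω) (Icc 0 1)) ∧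
        HaarVol.MemHolderSpace γ (fun t => HaarVol.partialZ Φ X W J t ω)) ∧
    ∃ D : Ω → ℝ, Measurable D ∧ (∀ ω, 0 < D ω) ∧ (∀ p : ℝ≥0, MemLp D p P) ∧
      ∀ᵐ ω ∂P, ∀ J : ℕ,
        HaarVol.MemHolderSpace γ (fun t => Z t ω - HaarVol.partialZ Φ X W J t ω) ∧
        HaarVol.holderNorm γ (fun t => Z t ω - HaarVol.partialZ Φ X W J t ω) ≤
          ENNReal.ofReal
            (D ω * (2 : ℝ) ^ (-((J : ℝ) * min (1 / 2 - γ) (α - 1 / 2))) * √(1 + (J : ℝ))) := by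
  have hα0 : 0 < α := by linarith
  have hΦc : Continuous Φ := hΦ.continuous
  have hcont : ∀ ω, HaarVol.HolderPath α (fun s => X s ω) →
      ContinuousOn (fun s => Φ (X s ω)) (Icc 0 1) := fun ω hω =>
    hΦc.comp_continuousOn (hω.continuousOn hα0)
  refine ⟨fun ω hω => ?_, ?_⟩
  · have hf := hcont ω hω
    obtain ⟨A, hA⟩ := isCompact_Icc.exists_bound_of_continuousOn hf
    refine ⟨HaarVol.exists_lipschitzOnWith_of_abs_sub_le fun s hs t ht =>
      HaarVol.abs_coefB_sub_le hf hA hs ht, fun j k hk =>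
      HaarVol.exists_lipschitzOnWith_of_abs_sub_le fun s hs t ht =>
        HaarVol.abs_coefA_sub_le hf hA hk hs ht, fun J => ?_⟩
    obtain ⟨K, hK⟩ := HaarVol.exists_abs_partialZ_sub_le (W := W) hf J
    exact ⟨HaarVol.exists_lipschitzOnWith_of_abs_sub_le hK,
      HaarVol.memHolderSpace_of_abs_sub_le (by linarith) hK⟩
  · obtain ⟨G, hGm, hG0, hGp, hG⟩ := hW.exists_memLp_dyadic_bound
    obtain ⟨A, hAm, hA0, hAp, hA⟩ := hX.exists_memLp_comp_bound hα0 hXα hc hΦ hΦL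
    set β := min (1 / 2 - γ) (α - 1 / 2) with hβdef
    have hβ : 0 < β := lt_min (by linarith) (by linarith)
    obtain ⟨κ, hκ0, hκ⟩ := HaarVol.exists_sum_sqrt_mul_two_rpow_le hβ
    have hB := hW.isBrownianWrt hX.measurable hXW
    have hconv : ∀ᵐ ω ∂P, ∀ n p : ℕ, p ≤ 2 ^ n → Tendsto
        (fun r => HaarVol.leftSum Φ X W (n + r) (p * 2 ^ r) ω) atTop
        (𝓝 (Z ((p : ℝ) / 2 ^ n) ω)) := by
      refine ae_all_iff.2 fun n => ae_all_iff.2 fun p => ?_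
      by_cases hp : p ≤ 2 ^ n
      · filter_upwards [HaarVol.ae_tendsto_leftSum hB hW.measurable hX.measurable hΦc hα0 hAm
          (hAp 2) hA hZ hp] with ω hω _
        exact hω
      · exact ae_of_all _ fun ω h => absurd h hp
    -- `12 = 3 * 2 * 2`: the block estimate, the bound on `haarLambda`, and the sum of the sup norm
    -- and the seminorm. The added `1` makes `D` strictly positive.
    refine ⟨fun ω => 12 * κ * (A ω * G ω) + 1, by fun_prop, fun ω => ?_, fun p => ?_, ?_⟩
    · have := mul_nonneg (hA0 ω) (hG0 ω)
      positivity
    · exact ((HaarVol.memLp_mul_of_forall hAp hGp p).const_mul (12 * κ)).add (memLp_const 1)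
    filter_upwards [hXα, hA, hG, hW.zero, hZc, hconv] with ω hXω hAω hGω hW0 hZω hcω J
    have hf := hcont ω hXω
    have hlim : ∀ n p : ℕ, p ≤ 2 ^ n → Tendsto
        (fun J => HaarVol.partialZ Φ X W J ((p : ℝ) / 2 ^ n) ω) atTop
        (𝓝 (Z ((p : ℝ) / 2 ^ n) ω)) := by
      intro n p hp
      -- From level `n` on, `p / 2^n` is a grid point, as required for the comparison with left
      -- sums. The partial sum of index `r + n` is compared with the left sum of level `n + (r +
      -- 1)`, hence the shift by one in `h1`.
      rw [← tendsto_add_atTop_iff_nat n]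
      have h1 := (tendsto_add_atTop_iff_nat 1).2 (hcω n p hp)
      have h2 : Tendsto (fun r => HaarVol.partialZ Φ X W (r + n) ((p : ℝ) / 2 ^ n) ω -
          HaarVol.leftSum Φ X W (n + (r + 1)) (p * 2 ^ (r + 1)) ω) atTop (𝓝 0) := by
        have h3 := ((HaarVol.tendsto_sqrt_mul_two_rpow (β := α - 1 / 2) (by linarith)).comp
          (tendsto_add_atTop_nat (n + 1))).const_mul (A ω * G ω)
        rw [mul_zero] at h3
        refine squeeze_zero_norm (fun r => ?_) h3
        have h4 := HaarVol.abs_partialZ_sub_leftSum_le hα0.le hf hW0 (hA0 ω) hAω.2 hGω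
          (J := r + n) (T := p * 2 ^ (r + 1)) (by
            rw [show r + n + 1 = n + (r + 1) by ring, pow_add 2 n]
            exact Nat.mul_le_mul_right _ hp)
        have e : ((p * 2 ^ (r + 1) : ℕ) : ℝ) / 2 ^ (r + n + 1) = (p : ℝ) / 2 ^ n := by
          rw [show r + n + 1 = n + (r + 1) by ring, pow_add _ n]
          push_cast
          exact mul_div_mul_right _ _ (by positivity)
        rw [e, show r + n + 1 = n + (r + 1) by ring] at h4
        rw [Real.norm_eq_abs]
        refine h4.trans (le_of_eq ?_)
        simp only [Function.comp]
        rw [show n + (r + 1) = r + (n + 1) by ring]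
      simpa using h2.add h1
    have hmain : ∀ s ∈ Icc (0 : ℝ) 1, ∀ t ∈ Icc (0 : ℝ) 1,
        |(Z s ω - HaarVol.partialZ Φ X W J s ω) - (Z t ω - HaarVol.partialZ Φ X W J t ω)| ≤
          3 * A ω * (2 * G ω) * (κ * (2 : ℝ) ^ (-((J : ℝ) * β)) * √(1 + (J : ℝ))) *
            |s - t| ^ γ := fun s hs t ht =>
      HaarVol.abs_sub_partialZ_sub_le hα0.le hf hAω.1 hAω.2 (by linarith [hG0 ω])
        (HaarVol.abs_haarLambda_le (hG0 ω) hGω) hγ (by linarith) (min_le_right _ _)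
        (min_le_left _ _) hκ hZω hlim J hs ht
    obtain ⟨C, hC⟩ := HaarVol.exists_abs_partialZ_sub_le (W := W) hf J
    obtain ⟨C', hC'⟩ := HaarVol.exists_lipschitzOnWith_of_abs_sub_le hC
    have hE : 0 ≤ (2 : ℝ) ^ (-((J : ℝ) * β)) * √(1 + (J : ℝ)) := by positivity
    have hAG := mul_nonneg (hA0 ω) (hG0 ω)
    refine ⟨⟨hZω.sub hC'.continuousOn, lt_of_le_of_lt (HaarVol.holderSeminorm_le
      fun s t h0 hst h1 => hmain s ⟨h0, by linarith⟩ t ⟨by linarith, h1⟩)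
      ENNReal.ofReal_lt_top⟩, ?_⟩
    refine (HaarVol.holderNorm_le hγ ?_ ?_ hmain).trans (ENNReal.ofReal_le_ofReal ?_)
    · have := hA0 ω
      have := hG0 ω
      positivity
    -- `Z 0 = 0` is recovered as the limit of the partial sums at the dyadic point `0`, where they
    -- all vanish.
    · have h0 := hlim 0 0 (by simp)
      simp only [Nat.cast_zero, zero_div, HaarVol.partialZ_zero hf] at h0
      rw [HaarVol.partialZ_zero hf, sub_zero]
      exact tendsto_nhds_unique h0 tendsto_const_nhds |>.symm ▸ rfl
    · nlinarith
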